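/- For $n=0,1,2,\dots$ let $$R_n(t)=-n!^4\Bigl(t+\frac n2\Bigr)\frac{\prod_{j=0}^n(t-j)\cdot\prod_{j=0}^n(t+n+j)}{\prod_{j=0}^n(t+j)^6},\qquad \tilde r_n=\sum_{k=1}^\infty R_n(k),$$ let $R_n(t)=\sum_{s=1}^6\sum_{j=0}^n A^{(n)}_{s,j}(t+j)^{-s}$ be the partial fraction expansion (with $A^{(n)}_{s,j}\in\mathbb Q$), and put $$\tilde u_n=\sum_{j=0}^nA^{(n)}_{5,j},\qquad \tilde w_n=\sum_{j=0}^nA^{(n)}_{3,j},\qquad \tilde v_n=\sum_{s=1}^6\sum_{j=0}^nA^{(n)}_{s,j}\sum_{l=1}^j\frac1{l^s}.$$ Then the series converge and $\tilde r_n=\tilde u_n\zeta(5)+\tilde w_n\zeta(3)-\tilde v_n$ for all $n\ge0$. Each of the four sequences $x=\tilde r,\tilde u,\tilde w,\tilde v$ satisfies, for all $n\ge2$, the recursion $$n^3(n+1)^3\tilde b_0(n-1)x_{n+1}-2n\tilde b_1(n)x_n-\tilde b_2(n)x_{n-1}+2n(n-1)^4(2n-3)\tilde b_0(n)x_{n-2}=0,$$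 where $$\tilde b_0(n)=41218n^7+35648n^6-932n^5-13190n^4-5128n^3+811n^2+957n+174,$$ $$\begin{aligned}\tilde b_1(n)={}&3874492n^{12}-14084302n^{11}+12425954n^{10}+8641603n^9-15230839n^8-1369195n^7\\&+8618417n^6-623249n^5-2785973n^4+308165n^3+495325n^2-40670n-37632,\end{aligned}$$ $$\begin{aligned}\tilde b_2(n)={}&2(48802112n^{13}-201803328n^{12}+267014032n^{11}-69927236n^{10}-95912858n^9+37524471n^8\\&+30257812n^7-9523224n^6-8524312n^5+2138687n^4+1507490n^3-398634n^2-111012n+33408).\end{aligned}$$ For all $n\ge1$ one has $\tilde r_n<0$, $\tilde u_n>0$, $\tilde w_n>0$, $\tilde v_n>0$. Finally, the polynomial $\lambda^3-188\lambda^2-2368\lambda+4$ has three real roots $\lambda_1,\lambda_2,\lambda_3$ with $|\lambda_1|<|\lambda_2|<|\lambda_3|$, where $\lambda_1,\lambda_3>0$, and $$\lim_{n\to\infty}\frac{\log|\tilde r_n|}n=\log\lambda_1,\qquad \lim_{n\to\infty}\frac{\log|\tilde u_n|}n=\lim_{n\to\infty}\frac{\log|\tilde w_n|}n=\lim_{n\to\infty}\frac{\log|\tilde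 v_n|}n=\log\lambda_3.$$ -/

import Mathlib

open Filter Topology
open scoped Nat

namespace Zeta5

/-- The real summand
`-n!⁴ (t + n/2) ∏_{j=0}^n (t - j) ∏_{j=0}^n (t + n + j) / ∏_{j=0}^n (t + j)⁶`
of the very-well-poised series. -/
noncomputable def summand (n : ℕ) (t : ℝ) : ℝ :=
  -((n ! : ℕ) : ℝ) ^ 4 * (t + (n : ℝ) / 2) *
    ((∏ j ∈ Finset.range (n + 1), (t - (j : ℝ))) *
      ∏ j ∈ Finset.range (n + 1), (t + (n : ℝ) + (j : ℝ))) /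
    ∏ j ∈ Finset.range (n + 1), (t + (j : ℝ)) ^ 6

/-- The linear form, as the sum of the series over `k = 1, 2, 3, …`. -/
noncomputable def rt (n : ℕ) : ℝ := ∑' k : ℕ, summand n ((k : ℝ) + 1)

/-- The expansion at `ε = 0` (with `ε = PowerSeries.X`) of `ε⁶ R(-j + ε)`, where `R` is the
summand regarded as a rational function over `ℚ`. For `0 ≤ j ≤ n` the factor `(t + j)⁶ = ε⁶` of
the denominator cancels, and the product of the other factors is invertible. -/
noncomputable def localExpansion (n j : ℕ) : PowerSeries ℚ :=
  (PowerSeries.C (-((n ! : ℕ) : ℚ) ^ 4) *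
      (PowerSeries.X + PowerSeries.C ((n : ℚ) / 2 - (j : ℚ))) *
      ((∏ i ∈ Finset.range (n + 1), (PowerSeries.X + PowerSeries.C (-(j : ℚ) - (i : ℚ)))) *
        ∏ i ∈ Finset.range (n + 1),
          (PowerSeries.X + PowerSeries.C ((n : ℚ) + (i : ℚ) - (j : ℚ))))) *
    (∏ i ∈ (Finset.range (n + 1)).erase j,
      (PowerSeries.X + PowerSeries.C ((i : ℚ) - (j : ℚ))) ^ 6)⁻¹

/-- The coefficient `A_{s,j}` (`1 ≤ s ≤ 6`, `0 ≤ j ≤ n`) of `1 / (t + j)^s` in the partial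
fraction expansion of the summand. -/
noncomputable def pfCoeff (n s j : ℕ) : ℚ := PowerSeries.coeff (6 - s) (localExpansion n j)

/-- The coefficient of `ζ(5)`. -/
noncomputable def ut (n : ℕ) : ℚ := ∑ j ∈ Finset.range (n + 1), pfCoeff n 5 j

/-- The coefficient of `ζ(3)`. -/
noncomputable def wt (n : ℕ) : ℚ := ∑ j ∈ Finset.range (n + 1), pfCoeff n 3 j

/-- The rational part (subtracted), which collects
`∑_{k ≥ 1} 1 / (k + j)^s = ζ(s) - ∑_{l=1}^j 1 / l^s` over all `s` and `j`. -/
noncomputable def vt (n : ℕ) : ℚ :=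
  ∑ s ∈ Finset.Icc 1 6, ∑ j ∈ Finset.range (n + 1),
    pfCoeff n s j * ∑ l ∈ Finset.Icc 1 j, 1 / (l : ℚ) ^ s

section Recursion

variable {K : Type*} [CommRing K]

/-- The polynomial `b̃₀`. -/
def b0 (n : K) : K :=
  41218 * n ^ 7 + 35648 * n ^ 6 - 932 * n ^ 5 - 13190 * n ^ 4 - 5128 * n ^ 3 + 811 * n ^ 2
    + 957 * n + 174

/-- The polynomial `b̃₁`. -/
def b1 (n : K) : K :=
  3874492 * n ^ 12 - 14084302 * n ^ 11 + 12425954 * n ^ 10 + 8641603 * n ^ 9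
    - 15230839 * n ^ 8 - 1369195 * n ^ 7 + 8618417 * n ^ 6 - 623249 * n ^ 5 - 2785973 * n ^ 4
    + 308165 * n ^ 3 + 495325 * n ^ 2 - 40670 * n - 37632

/-- The polynomial `b̃₂`. -/
def b2 (n : K) : K :=
  2 * (48802112 * n ^ 13 - 201803328 * n ^ 12 + 267014032 * n ^ 11 - 69927236 * n ^ 10
    - 95912858 * n ^ 9 + 37524471 * n ^ 8 + 30257812 * n ^ 7 - 9523224 * n ^ 6
    - 8524312 * n ^ 5 + 2138687 * n ^ 4 + 1507490 * n ^ 3 - 398634 * n ^ 2 - 111012 * n + 33408)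

/-- The third-order recursion. It involves the index `n - 2`, so `n` runs over `2, 3, …`. -/
def SatisfiesRecursion (x : ℕ → K) : Prop :=
  ∀ n : ℕ, 2 ≤ n →
    (n : K) ^ 3 * ((n : K) + 1) ^ 3 * b0 ((n : K) - 1) * x (n + 1)
      - 2 * (n : K) * b1 (n : K) * x n
      - b2 (n : K) * x (n - 1)
      + 2 * (n : K) * ((n : K) - 1) ^ 4 * (2 * (n : K) - 3) * b0 (n : K) * x (n - 2) = 0

end Recursion

/-- `a` is the logarithmic growth rate of the sequence `x`: `log |x n| / n → a`. -/
def HasLogRate (x : ℕ → ℝ) (a : ℝ) : Prop :=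
  Tendsto (fun n : ℕ => Real.log |x n| / (n : ℝ)) atTop (𝓝 a)

end Zeta5

/-! The recursion comes from creative telescoping. With m = n - 2, the recursion operator applied to
R(t) equals `antidiff m (t + 1) - antidiff m t` for an explicit rational function `antidiff`; after
clearing denominators this is a polynomial identity (`certPoly_identity`), so it holds over any
field with 2 ≠ 0 (`term_recursion`). It is used twice. Over ℝ, summing over t = 1, 2, … gives the
recursion for `rt`, since the certificate vanishes at t = 1 and at infinity. Over the fraction field
of ℚ⟦ε⟧, summing over t = ε - j with 0 ≤ j ≤ m + 3 leaves only two boundary values, both regular at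
ε = 0. After multiplication by ε⁶ they do not reach the orders below six, so every sum ∑_j A_{s,j}
satisfies the recursion (`sum_pfCoeff_satisfiesRecursion`), in particular `ut` and `wt`. The linear
form then yields it for `vt`.

The linear form itself is partial fractions plus two vanishing facts: R changes sign under t ↦ -n -
t, which kills ∑_j A_{s,j} for even s, and tR(t) → 0 kills it for s = 1.

The asymptotics use only the recursion, a crude bound and a few initial values. Written as x_{m+3} =
A x_{m+2} + B x_{m+1} - C x_m, it has A ≥ 100, B ≥ 1000, 0 ≤ C ≤ 4 for all m ≥ 0, and A, B, C → 188,
2368, 4. The initial values force `ut` and `wt` to grow by a factor of at least 100 per step from n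
= 1 on, while the positive sequence -`rt`, being bounded uniformly in n, must shrink by such a
factor at every step. In both cases the ratio of the smaller to the larger neighbour solves an
asymptotically contracting fixed-point equation (`tendsto_of_contraction`), so it converges to 1/λ₃
or to λ₁. Finally `vt` differs from ũζ(5) + w̃ζ(3) by the bounded sequence `rt`. -/

namespace Zeta5

/-! ### The certificate polynomial and its defining identity. -/

section Certificate

variable {K : Type*} [CommRing K]

/-- The coefficient of `y ^ 0` in `certPoly`. -/
def certCoeff0 (n : K) : K :=
  329744 * n ^ 27 - 3836616 * n ^ 26 + 17651672 * n ^ 25 - 36967472 * n ^ 24 + 14233880 * n ^ 23 +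
  94182856 * n ^ 22 - 185077940 * n ^ 21 + 59195644 * n ^ 20 + 223890508 * n ^ 19 - 296990308 * n ^
  18 + 31755736 * n ^ 17 + 221363816 * n ^ 16 - 178747152 * n ^ 15 - 3410848 * n ^ 14 + 77941980 *
  n ^ 13 - 40614516 * n ^ 12 + 531420 * n ^ 11 + 6773316 * n ^ 10 - 2509848 * n ^ 9 + 304128 * n ^
  8

/-- The coefficient of `y ^ 1` in `certPoly`. -/
def certCoeff1 (n : K) : K :=
  2802824 * n ^ 26 - 32034184 * n ^ 25 + 149384180 * n ^ 24 - 343423360 * n ^ 23 + 293339640 * n ^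
  22 + 399714568 * n ^ 21 - 1283239200 * n ^ 20 + 1062534146 * n ^ 19 + 475829680 * n ^ 18 -
  1604499074 * n ^ 17 + 1027125984 * n ^ 16 + 259043732 * n ^ 15 - 716347592 * n ^ 14 + 337194788 *
  n ^ 13 + 32786928 * n ^ 12 - 83789430 * n ^ 11 + 21575448 * n ^ 10 + 4802622 * n ^ 9 - 3257892 *
  n ^ 8 + 456192 * n ^ 7

/-- The coefficient of `y ^ 2` in `certPoly`. -/
def certCoeff2 (n : K) : K :=
  11458604 * n ^ 25 - 130602018 * n ^ 24 + 627165756 * n ^ 23 - 1592635324 * n ^ 22 + 2031152342 *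
  n ^ 21 - 225756504 * n ^ 20 - 3366280011 * n ^ 19 + 4978623088 * n ^ 18 - 2204857617 * n ^ 17 -
  1955809634 * n ^ 16 + 3145926526 * n ^ 15 - 1430769348 * n ^ 14 - 186321236 * n ^ 13 + 412806788
  * n ^ 12 - 84799287 * n ^ 11 - 55075872 * n ^ 10 + 28304451 * n ^ 9 - 1085304 * n ^ 8 - 1749528 *
  n ^ 7 + 304128 * n ^ 6

/-- The coefficient of `y ^ 3` in `certPoly`. -/
def certCoeff3 (n : K) : K :=
  30295230 * n ^ 24 - 348635212 * n ^ 23 + 1740429026 * n ^ 22 - 4857272972 * n ^ 21 + 7947465356 *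
  n ^ 20 - 6563962259 * n ^ 19 - 898798792 * n ^ 18 + 8575950576 * n ^ 17 - 9300800117 * n ^ 16 +
  4049349806 * n ^ 15 + 425440918 * n ^ 14 - 1069253752 * n ^ 13 + 117899710 * n ^ 12 + 241393405 *
  n ^ 11 - 75639552 * n ^ 10 - 29555796 * n ^ 9 + 15711189 * n ^ 8 + 1682076 * n ^ 7 - 2002968 * n
  ^ 6 + 304128 * n ^ 5

/-- The coefficient of `y ^ 4` in `certPoly`. -/
def certCoeff4 (n : K) : K :=
  57870072 * n ^ 23 - 674397776 * n ^ 22 + 3485957072 * n ^ 21 - 10464475288 * n ^ 20 + 19957579992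
  * n ^ 19 - 24570624164 * n ^ 18 + 18315574288 * n ^ 17 - 5820925916 * n ^ 16 - 2227176560 * n ^
  15 + 2345301448 * n ^ 14 + 102986868 * n ^ 13 - 681380764 * n ^ 12 + 38946932 * n ^ 11 +
  200799136 * n ^ 10 - 43994028 * n ^ 9 - 39090816 * n ^ 8 + 17154972 * n ^ 7 + 1593372 * n ^ 6 -
  2002968 * n ^ 5 + 304128 * n ^ 4

/-- The coefficient of `y ^ 5` in `certPoly`. -/
def certCoeff5 (n : K) : K :=
  80746062 * n ^ 22 - 932051494 * n ^ 21 + 4799535378 * n ^ 20 - 14465261080 * n ^ 19 + 28036025834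
  * n ^ 18 - 35882815977 * n ^ 17 + 29410912429 * n ^ 16 - 13228044540 * n ^ 15 + 758948244 * n ^
  14 + 2016967948 * n ^ 13 - 245975894 * n ^ 12 - 501250608 * n ^ 11 + 37158584 * n ^ 10 +
  169661503 * n ^ 9 - 29836401 * n ^ 8 - 42022932 * n ^ 7 + 17408412 * n ^ 6 + 1593372 * n ^ 5 -
  2002968 * n ^ 4 + 304128 * n ^ 3

/-- The coefficient of `y ^ 6` in `certPoly`. -/
def certCoeff6 (n : K) : K :=
  66278544 * n ^ 21 - 664281542 * n ^ 20 + 2732471232 * n ^ 19 - 5315993364 * n ^ 18 + 1743990470 *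
  n ^ 17 + 16018847520 * n ^ 16 - 42174740637 * n ^ 15 + 54178960984 * n ^ 14 - 38288847927 * n ^
  13 + 10144850100 * n ^ 12 + 5199276425 * n ^ 11 - 3943346484 * n ^ 10 - 601344567 * n ^ 9 +
  986735566 * n ^ 8 + 197718924 * n ^ 7 - 343315404 * n ^ 6 + 9689552 * n ^ 5 + 76080384 * n ^ 4 -
  21349872 * n ^ 3 - 4152096 * n ^ 2 + 2873088 * n - 400896

/-- The coefficient of `y ^ 7` in `certPoly`. -/
def certCoeff7 (n : K) : K :=
  -14220210 * n ^ 20 + 459400232 * n ^ 19 - 4311443310 * n ^ 18 + 20788349532 * n ^ 17 -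
  61236110642 * n ^ 16 + 117700919571 * n ^ 15 - 148713599310 * n ^ 14 + 116041471478 * n ^ 13 -
  41627429801 * n ^ 12 - 10393701299 * n ^ 11 + 14125885206 * n ^ 10 - 131418832 * n ^ 9 -
  3484596585 * n ^ 8 - 19850488 * n ^ 7 + 1129713728 * n ^ 6 - 168708196 * n ^ 5 - 231904336 * n ^
  4 + 85962946 * n ^ 3 + 9834156 * n ^ 2 - 10090608 * n + 1536768

/-- The coefficient of `y ^ 8` in `certPoly`. -/
def certCoeff8 (n : K) : K :=
  -127446056 * n ^ 19 + 1843427148 * n ^ 18 - 11699309496 * n ^ 17 + 42796424970 * n ^ 16 -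
  98956951972 * n ^ 15 + 147788105850 * n ^ 14 - 136503175928 * n ^ 13 + 63021345864 * n ^ 12 +
  5353578231 * n ^ 11 - 19141669962 * n ^ 10 + 2555385200 * n ^ 9 + 4673424948 * n ^ 8 - 690397634
  * n ^ 7 - 1436351712 * n ^ 6 + 378516876 * n ^ 5 + 268934034 * n ^ 4 - 128127265 * n ^ 3 -
  6948276 * n ^ 2 + 13506924 * n - 2271744

/-- The coefficient of `y ^ 9` in `certPoly`. -/
def certCoeff9 (n : K) : K :=
  -185851962 * n ^ 18 + 2299359498 * n ^ 17 - 12329954368 * n ^ 16 + 37174755742 * n ^ 15 -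
  68083648966 * n ^ 14 + 74995598863 * n ^ 13 - 42586709069 * n ^ 12 + 1308363705 * n ^ 11 +
  11887548542 * n ^ 10 - 2876173410 * n ^ 9 - 2871970178 * n ^ 8 + 793863011 * n ^ 7 + 848487341 *
  n ^ 6 - 308509143 * n ^ 5 - 144534979 * n ^ 4 + 85608992 * n ^ 3 + 533415 * n ^ 2 - 8370618 * n +
  1603584

/-- The coefficient of `y ^ 10` in `certPoly`. -/
def certCoeff10 (n : K) : K :=
  -141789920 * n ^ 17 + 1452393096 * n ^ 16 - 6224354700 * n ^ 15 + 14388660354 * n ^ 14 -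
  18876431952 * n ^ 13 + 12613052188 * n ^ 12 - 1270620274 * n ^ 11 - 3410477974 * n ^ 10 +
  1023776363 * n ^ 9 + 848773974 * n ^ 8 - 265947231 * n ^ 7 - 242334766 * n ^ 6 + 88518021 * n ^ 5
  + 36867442 * n ^ 4 - 22568123 * n ^ 3 + 893142 * n ^ 2 + 2124888 * n - 534528

/-- The coefficient of `y ^ 11` in `certPoly`. -/
def certCoeff11 (n : K) : K :=
  -46493904 * n ^ 16 + 345919280 * n ^ 15 - 1046001760 * n ^ 14 + 1572607702 * n ^ 13 - 1033873726
  * n ^ 12 - 97024904 * n ^ 11 + 418845362 * n ^ 10 + 8319138 * n ^ 9 - 143494523 * n ^ 8 -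
  19613215 * n ^ 7 + 39484120 * n ^ 6 + 7841210 * n ^ 5 - 5378165 * n ^ 4 - 1196471 * n ^ 3 - 82476
  * n ^ 2 + 75516 * n + 66816

/-- The coefficient of `y ^ 12` in `certPoly`. -/
def certCoeff12 (n : K) : K :=
  1154104 * n ^ 15 - 12686232 * n ^ 14 + 58868856 * n ^ 13 - 143658952 * n ^ 12 + 170614016 * n ^
  11 - 50710172 * n ^ 10 - 69227104 * n ^ 9 + 35054880 * n ^ 8 + 26502780 * n ^ 7 - 9842684 * n ^ 6
  - 9153776 * n ^ 5 + 1503152 * n ^ 4 + 1840740 * n ^ 3 - 109272 * n ^ 2 - 150336 * n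

/-- The coefficient of `y ^ 13` in `certPoly`. -/
def certCoeff13 (n : K) : K :=
  577052 * n ^ 14 - 5683628 * n ^ 13 + 22132158 * n ^ 12 - 35951308 * n ^ 11 + 16934536 * n ^ 10 +
  13506900 * n ^ 9 - 10285862 * n ^ 8 - 5462473 * n ^ 7 + 3037251 * n ^ 6 + 2051560 * n ^ 5 -
  499366 * n ^ 4 - 430509 * n ^ 3 + 37671 * n ^ 2 + 36018 * n

/-- The coefficient of `y ^ 14` in `certPoly`. -/
def certCoeff14 (n : K) : K :=
  247308 * n ^ 13 - 2011884 * n ^ 12 + 4499424 * n ^ 11 - 2876196 * n ^ 10 - 1542624 * n ^ 9 +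
  1669374 * n ^ 8 + 665868 * n ^ 7 - 511986 * n ^ 6 - 275976 * n ^ 5 + 87942 * n ^ 4 + 60756 * n ^
  3 - 6786 * n ^ 2 - 5220 * n

/-- The coefficient of `y ^ 15` in `certPoly`. -/
def certCoeff15 (n : K) : K :=
  82436 * n ^ 12 - 258448 * n ^ 11 + 207568 * n ^ 10 + 79108 * n ^ 9 - 118668 * n ^ 8 - 36882 * n ^
  7 + 37546 * n ^ 6 + 17068 * n ^ 5 - 6652 * n ^ 4 - 3946 * n ^ 3 + 522 * n ^ 2 + 348 * n

/-- The polynomial part of the telescoping certificate, in the variable `y = t + n`. -/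
def certPoly (n y : K) : K :=
  certCoeff15 n * y ^ 15 + certCoeff14 n * y ^ 14 + certCoeff13 n * y ^ 13 + certCoeff12 n * y ^
  12 + certCoeff11 n * y ^ 11 + certCoeff10 n * y ^ 10 + certCoeff9 n * y ^ 9 + certCoeff8 n * y
  ^ 8 + certCoeff7 n * y ^ 7 + certCoeff6 n * y ^ 6 + certCoeff5 n * y ^ 5 + certCoeff4 n * y ^ 4
  + certCoeff3 n * y ^ 3 + certCoeff2 n * y ^ 2 + certCoeff1 n * y + certCoeff0 n

-- The telescoping relation with denominators cleared: the right side carries the four shifted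
-- summands divided by their common factor, and the left side the two values of the certificate, all
-- in y = t + n.
set_option maxHeartbeats 4000000 in
theorem certPoly_identity (n y : K) :
    certPoly n (y + 1) * (y - n + 1) * (y - n) ^ 6 * (y + n - 3)
      - certPoly n y * (y - 2 * n + 1) * (y + 1) ^ 6 * y
    = -(2 * n * (n - 1) ^ 4 * (2 * n - 3) * b0 n) *
        ((2 * y - n - 2) * (y - 2) * (y - 1) ^ 7 * y ^ 7 * (y + 1) ^ 6)
      + b2 n * ((n - 1) ^ 4 * (2 * y - n - 1) * (y - 2 * n + 1) * (y + n - 3) * (y + n - 2) *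
        (y - 1) * y ^ 7 * (y + 1) ^ 6)
      + 2 * n * b1 n * (((n - 1) * n) ^ 4 * (2 * y - n) * (y - 2 * n + 1) * (y - 2 * n) *
        (y + n - 3) * (y + n - 2) * (y + n - 1) * (y + n) * (y + 1) ^ 6 * y)
      - n ^ 3 * (n + 1) ^ 3 * b0 (n - 1) * (((n - 1) * n * (n + 1)) ^ 4 * (2 * y - n + 1) *
        (y - 2 * n + 1) * (y - 2 * n) * (y - 2 * n - 1) * (y + n - 3) * (y + n - 2) *
        (y + n - 1) * (y + n) * (y + n + 1) * (y + n + 2)) := by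
  simp only [certPoly, b0, b1, b2, certCoeff0, certCoeff1, certCoeff2, certCoeff3, certCoeff4, certCoeff5, certCoeff6, certCoeff7,
    certCoeff8, certCoeff9, certCoeff10, certCoeff11, certCoeff12, certCoeff13, certCoeff14, certCoeff15]
  ring

end Certificate

/-! ### The telescoping relation for the rational summand over a field. -/

section Telescoping

variable {K : Type*} [Field K]

/-- The summand as a rational expression over an arbitrary field. -/
noncomputable def term (n : ℕ) (t : K) : K :=
  -((n ! : ℕ) : K) ^ 4 * (t + (n : K) / 2) *
    ((∏ j ∈ Finset.range (n + 1), (t - (j : K))) *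
      ∏ j ∈ Finset.range (n + 1), (t + (n : K) + (j : K))) /
    ∏ j ∈ Finset.range (n + 1), (t + (j : K)) ^ 6

/-- The rational certificate whose forward difference is the recursion applied to `term`. -/
noncomputable def antidiff (m : ℕ) (t : K) : K :=
  ((m ! : ℕ) : K) ^ 4 * certPoly ((m : K) + 2) (t + m + 2) *
    ((∏ j ∈ Finset.range (m + 2), (t - (j : K))) *
      ∏ j ∈ Finset.range (m + 1), (t + (m : K) + (j : K))) /
    (2 * (t + m) * (t + m + 1) * ∏ j ∈ Finset.range (m + 3), (t + (j : K)) ^ 6)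

/-- Raising n moves both ends of the window t + n, …, t + 2n: one factor leaves at the bottom and
two enter at the top. Dividing by the lost factors t + m, t + m + 1 accounts for these linear
factors in the denominator of `antidiff`. -/
theorem prod_shift_succ (n : ℕ) (t : K) :
    (∏ j ∈ Finset.range (n + 2), (t + ((n + 1 : ℕ) : K) + (j : K))) * (t + n) =
      (∏ j ∈ Finset.range (n + 1), (t + (n : K) + (j : K))) *
        ((t + 2 * n + 1) * (t + 2 * n + 2)) := by
  have h := Finset.prod_range_succ' (fun j : ℕ => t + (n : K) + (j : K)) (n + 2)
  rw [Finset.prod_range_succ, Finset.prod_range_succ] at h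
  push_cast at h ⊢
  rw [add_zero] at h
  have e : (∏ j ∈ Finset.range (n + 2), (t + ((n : K) + 1) + (j : K))) =
      ∏ j ∈ Finset.range (n + 2), (t + (n : K) + ((j : K) + 1)) :=
    Finset.prod_congr rfl fun j _ => by ring
  rw [e, ← h]
  ring

theorem prod_shift_add_one (n : ℕ) (t : K) :
    (∏ j ∈ Finset.range (n + 1), (t + 1 + (n : K) + (j : K))) * (t + n) =
      (∏ j ∈ Finset.range (n + 1), (t + (n : K) + (j : K))) * (t + 2 * n + 1) := by
  have h := Finset.prod_range_succ' (fun j : ℕ => t + (n : K) + (j : K)) (n + 1)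
  rw [Finset.prod_range_succ] at h
  push_cast at h
  rw [add_zero] at h
  have e : (∏ j ∈ Finset.range (n + 1), (t + 1 + (n : K) + (j : K))) =
      ∏ j ∈ Finset.range (n + 1), (t + (n : K) + ((j : K) + 1)) :=
    Finset.prod_congr rfl fun j _ => by ring
  rw [e, ← h]
  ring

theorem prod_sub_add_one (n : ℕ) (t : K) :
    (∏ j ∈ Finset.range (n + 1), (t + 1 - (j : K))) =
      (∏ j ∈ Finset.range n, (t - (j : K))) * (t + 1) := by
  rw [Finset.prod_range_succ']
  push_cast
  rw [sub_zero]
  congr 1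
  exact Finset.prod_congr rfl fun j _ => by ring

theorem prod_add_pow_add_one (n : ℕ) (t : K) :
    (∏ j ∈ Finset.range n, (t + 1 + (j : K)) ^ 6) * t ^ 6 =
      ∏ j ∈ Finset.range (n + 1), (t + (j : K)) ^ 6 := by
  rw [Finset.prod_range_succ']
  push_cast
  rw [add_zero]
  congr 1
  exact Finset.prod_congr rfl fun j _ => by ring

set_option maxHeartbeats 2000000 in
theorem term_recursion (h2 : (2 : K) ≠ 0) (m : ℕ) (t : K) (ht : ∀ k : ℕ, t + k ≠ 0) :
    ((m : K) + 2) ^ 3 * ((m : K) + 3) ^ 3 * b0 ((m : K) + 1) * term (m + 3) t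
      - 2 * ((m : K) + 2) * b1 ((m : K) + 2) * term (m + 2) t
      - b2 ((m : K) + 2) * term (m + 1) t
      + 2 * ((m : K) + 2) * ((m : K) + 1) ^ 4 * (2 * (m : K) + 1) * b0 ((m : K) + 2) * term m t
    = antidiff m (t + 1) - antidiff m t := by
  have n0 : t + m ≠ 0 := ht m
  have n1 : t + m + 1 ≠ 0 := by have := ht (m + 1); push_cast at this; rwa [← add_assoc] at this
  have n2 : t + m + 2 ≠ 0 := by have := ht (m + 2); push_cast at this; rwa [← add_assoc] at this
  have n3 : t + m + 3 ≠ 0 := by have := ht (m + 3); push_cast at this; rwa [← add_assoc] at this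
  have nt : t ≠ 0 := by simpa using ht 0
  set P := ∏ j ∈ Finset.range (m + 1), (t - (j : K)) with hP
  set Q := ∏ j ∈ Finset.range (m + 1), (t + (m : K) + (j : K)) with hQ
  set D := ∏ j ∈ Finset.range (m + 1), (t + (j : K)) ^ 6 with hD
  have nD : D ≠ 0 := Finset.prod_ne_zero_iff.2 fun j _ => pow_ne_zero _ (ht j)
  have D2 : ∏ j ∈ Finset.range (m + 2), (t + (j : K)) ^ 6 = D * (t + m + 1) ^ 6 := by
    rw [Finset.prod_range_succ]; push_cast; ring
  have D3 : ∏ j ∈ Finset.range (m + 3), (t + (j : K)) ^ 6 =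
      D * (t + m + 1) ^ 6 * (t + m + 2) ^ 6 := by
    rw [Finset.prod_range_succ, D2]; push_cast; ring
  have D4 : ∏ j ∈ Finset.range (m + 4), (t + (j : K)) ^ 6 =
      D * (t + m + 1) ^ 6 * (t + m + 2) ^ 6 * (t + m + 3) ^ 6 := by
    rw [Finset.prod_range_succ, D3]; push_cast; ring
  have D5 : ∏ j ∈ Finset.range (m + 3), (t + 1 + (j : K)) ^ 6 =
      D * (t + m + 1) ^ 6 * (t + m + 2) ^ 6 * (t + m + 3) ^ 6 / t ^ 6 := by
    rw [eq_div_iff (pow_ne_zero _ nt), prod_add_pow_add_one, D4]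
  have P2 : ∏ j ∈ Finset.range (m + 2), (t - (j : K)) = P * (t - m - 1) := by
    rw [Finset.prod_range_succ]; push_cast; ring
  have P3 : ∏ j ∈ Finset.range (m + 3), (t - (j : K)) = P * (t - m - 1) * (t - m - 2) := by
    rw [Finset.prod_range_succ, P2]; push_cast; ring
  have P4 : ∏ j ∈ Finset.range (m + 4), (t - (j : K)) =
      P * (t - m - 1) * (t - m - 2) * (t - m - 3) := by
    rw [Finset.prod_range_succ, P3]; push_cast; ring
  have P5 : ∏ j ∈ Finset.range (m + 2), (t + 1 - (j : K)) = P * (t + 1) :=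
    prod_sub_add_one (m + 1) t
  have Q2 : ∏ j ∈ Finset.range (m + 2), (t + ((m + 1 : ℕ) : K) + (j : K)) =
      Q * ((t + 2 * m + 1) * (t + 2 * m + 2)) / (t + m) := by
    rw [eq_div_iff n0, prod_shift_succ]
  have Q3 : ∏ j ∈ Finset.range (m + 3), (t + ((m + 2 : ℕ) : K) + (j : K)) =
      Q * ((t + 2 * m + 1) * (t + 2 * m + 2)) / (t + m) *
        ((t + 2 * m + 3) * (t + 2 * m + 4)) / (t + m + 1) := by
    have := prod_shift_succ (m + 1) t
    rw [Q2] at this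
    rw [eq_div_iff n1]
    push_cast at this ⊢
    rw [add_assoc t (m : K) 1]
    refine Eq.trans ?_ (this.trans ?_)
    · congr 1; exact Finset.prod_congr rfl fun j _ => by ring
    · ring
  have Q4 : ∏ j ∈ Finset.range (m + 4), (t + ((m + 3 : ℕ) : K) + (j : K)) =
      Q * ((t + 2 * m + 1) * (t + 2 * m + 2)) / (t + m) *
        ((t + 2 * m + 3) * (t + 2 * m + 4)) / (t + m + 1) *
        ((t + 2 * m + 5) * (t + 2 * m + 6)) / (t + m + 2) := by
    have := prod_shift_succ (m + 2) t
    rw [Q3] at this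
    rw [eq_div_iff n2]
    push_cast at this ⊢
    rw [add_assoc t (m : K) 2]
    refine Eq.trans ?_ (this.trans ?_)
    · congr 1; exact Finset.prod_congr rfl fun j _ => by ring
    · ring
  have Q5 : ∏ j ∈ Finset.range (m + 1), (t + 1 + (m : K) + (j : K)) =
      Q * (t + 2 * m + 1) / (t + m) := by
    rw [eq_div_iff n0, prod_shift_add_one]
  clear_value P Q D
  -- V is the common factor of all six terms: each of them is V times a polynomial, and these
  -- polynomials are those of `certPoly_identity` at n = m + 2, y = t + m + 2.
  obtain ⟨V, hV⟩ : ∃ V, V = ((m ! : ℕ) : K) ^ 4 * P * Q /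
    (2 * (t + m) * (t + m + 1) * (t + m + 2) *
      (D * (t + m + 1) ^ 6 * (t + m + 2) ^ 6 * (t + m + 3) ^ 6)) := ⟨_, rfl⟩
  have f1 : (((m + 1)! : ℕ) : K) = (m + 1) * (m ! : ℕ) := by
    rw [Nat.factorial_succ]; push_cast; ring
  have f2 : (((m + 2)! : ℕ) : K) = (m + 2) * ((m + 1) * (m ! : ℕ)) := by
    rw [Nat.factorial_succ, Nat.cast_mul, f1]; push_cast; ring
  have f3 : (((m + 3)! : ℕ) : K) = (m + 3) * ((m + 2) * ((m + 1) * (m ! : ℕ))) := by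
    rw [Nat.factorial_succ, Nat.cast_mul, f2]; push_cast; ring
  have T0 : term m t = -V * ((2 * t + m) * (t + m) * (t + m + 1) ^ 7 * (t + m + 2) ^ 7 *
      (t + m + 3) ^ 6) := by
    rw [term, ← hP, ← hQ, ← hD, hV]
    have e : t + (m : K) / 2 = (2 * t + m) / 2 := by field_simp
    rw [e]
    -- Linear forms become opaque atoms here and below, so that cancellation treats them as
    -- monomials and never expands them.
    generalize 2 * t + (m : K) = g at *
    generalize t + (m : K) + 3 = d at *
    generalize t + (m : K) + 2 = c at *
    generalize t + (m : K) + 1 = b at *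
    generalize t + (m : K) = a at *
    field_simp
  have T1 : term (m + 1) t = -V * ((m + 1) ^ 4 * (2 * t + m + 1) * (t - m - 1) *
      (t + 2 * m + 1) * (t + 2 * m + 2) * (t + m + 1) * (t + m + 2) ^ 7 * (t + m + 3) ^ 6) := by
    rw [term, P2, Q2, D2, f1]
    push_cast
    have e : t + ((m : K) + 1) / 2 = (2 * t + m + 1) / 2 := by field_simp; ring
    rw [e]
    generalize 2 * t + (m : K) + 1 = g at *
    generalize t + (m : K) + 3 = d at *
    generalize t + (m : K) + 2 = c at *
    generalize t + (m : K) + 1 = b at *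
    generalize t + (m : K) = a at *
    generalize t - (m : K) - 1 = x0 at *
    generalize t + 2 * (m : K) + 1 = x1 at *
    generalize t + 2 * (m : K) + 2 = x2 at *
    generalize (m : K) + 1 = x3 at *
    have h : V * (b * c ^ 7 * d ^ 6) = ((m ! : ℕ) : K) ^ 4 * P * Q / (2 * a * (D * b ^ 6)) := by
      rw [hV]; field_simp
    linear_combination (x3 ^ 4 * g * x0 * x1 * x2) * h
  have T2 : term (m + 2) t = -V * (((m + 1) * (m + 2)) ^ 4 * (2 * t + m + 2) * (t - m - 1) *
      (t - m - 2) * (t + 2 * m + 1) * (t + 2 * m + 2) * (t + 2 * m + 3) * (t + 2 * m + 4) *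
      (t + m + 2) * (t + m + 3) ^ 6) := by
    rw [term, P3, Q3, D3, f2]
    push_cast
    have e : t + ((m : K) + 2) / 2 = (2 * t + m + 2) / 2 := by field_simp; ring
    rw [e]
    generalize 2 * t + (m : K) + 2 = g at *
    generalize t + (m : K) + 3 = d at *
    generalize t + (m : K) + 2 = c at *
    generalize t + (m : K) + 1 = b at *
    generalize t + (m : K) = a at *
    generalize t - (m : K) - 1 = x0 at *
    generalize t - (m : K) - 2 = x1 at *
    generalize t + 2 * (m : K) + 1 = x2 at *
    generalize t + 2 * (m : K) + 2 = x3 at *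
    generalize t + 2 * (m : K) + 3 = x4 at *
    generalize t + 2 * (m : K) + 4 = x5 at *
    generalize (m : K) + 1 = x6 at *
    generalize (m : K) + 2 = x7 at *
    have h : V * (c * d ^ 6) = ((m ! : ℕ) : K) ^ 4 * P * Q / (2 * a * b * (D * b ^ 6 * c ^ 6)) := by
      rw [hV]; field_simp
    linear_combination ((x6 * x7) ^ 4 * g * x0 * x1 * x2 * x3 * x4 * x5) * h
  have T3 : term (m + 3) t = -V * (((m + 1) * (m + 2) * (m + 3)) ^ 4 * (2 * t + m + 3) *
      (t - m - 1) * (t - m - 2) * (t - m - 3) * (t + 2 * m + 1) * (t + 2 * m + 2) *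
      (t + 2 * m + 3) * (t + 2 * m + 4) * (t + 2 * m + 5) * (t + 2 * m + 6)) := by
    rw [term, P4, Q4, D4, hV, f3]
    push_cast
    have e : t + ((m : K) + 3) / 2 = (2 * t + m + 3) / 2 := by field_simp; ring
    rw [e]
    generalize 2 * t + (m : K) + 3 = g at *
    generalize t + (m : K) + 3 = d at *
    generalize t + (m : K) + 2 = c at *
    generalize t + (m : K) + 1 = b at *
    generalize t + (m : K) = a at *
    generalize t - (m : K) - 1 = x0 at *
    generalize t - (m : K) - 2 = x1 at *
    generalize t - (m : K) - 3 = x2 at *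
    generalize t + 2 * (m : K) + 1 = x3 at *
    generalize t + 2 * (m : K) + 2 = x4 at *
    generalize t + 2 * (m : K) + 3 = x5 at *
    generalize t + 2 * (m : K) + 4 = x6 at *
    generalize t + 2 * (m : K) + 5 = x7 at *
    generalize t + 2 * (m : K) + 6 = x8 at *
    generalize (m : K) + 1 = x9 at *
    generalize (m : K) + 2 = x10 at *
    generalize (m : K) + 3 = x11 at *
    ring
  have A0 : antidiff m t = V * (certPoly ((m : K) + 2) (t + m + 2) * (t - m - 1) *
      (t + m + 3) ^ 6 * (t + m + 2)) := by
    rw [antidiff, P2, ← hQ, D3, hV]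
    generalize t + (m : K) + 3 = d at *
    generalize t + (m : K) + 2 = c at *
    generalize t + (m : K) + 1 = b at *
    generalize t + (m : K) = a at *
    generalize t - (m : K) - 1 = x0 at *
    field_simp
  have A1 : antidiff m (t + 1) = V * (certPoly ((m : K) + 2) (t + m + 2 + 1) * (t + 1) *
      t ^ 6 * (t + 2 * m + 1)) := by
    have e1 : t + 1 + (m : K) + 2 = t + m + 2 + 1 := by ring
    have e2 : t + 1 + (m : K) = t + m + 1 := by ring
    have e3 : t + (m : K) + 1 + 1 = t + m + 2 := by ring
    rw [antidiff, P5, Q5, D5, hV, e1, e2, e3]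
    field_simp
  rw [T0, T1, T2, T3, A0, A1]
  have key := certPoly_identity ((m : K) + 2) (t + m + 2)
  have e4 : (m : K) + 2 - 1 = m + 1 := by ring
  have e5 : (m : K) + 2 + 1 = m + 3 := by ring
  rw [e4, e5] at key
  generalize certPoly ((m : K) + 2) (t + m + 2) = c0 at *
  generalize certPoly ((m : K) + 2) (t + m + 2 + 1) = c1 at *
  generalize b0 ((m : K) + 1) = B0 at *
  generalize b0 ((m : K) + 2) = B3 at *
  generalize b1 ((m : K) + 2) = B1 at *
  generalize b2 ((m : K) + 2) = B2 at *
  linear_combination (-V) * key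

end Telescoping

/-- Working with m = n - 2 removes the truncated subtractions in the indices. -/
theorem satisfiesRecursion_of_shift {K : Type*} [CommRing K] {x : ℕ → K}
    (h : ∀ m : ℕ, ((m : K) + 2) ^ 3 * ((m : K) + 3) ^ 3 * b0 ((m : K) + 1) * x (m + 3)
      - 2 * ((m : K) + 2) * b1 ((m : K) + 2) * x (m + 2)
      - b2 ((m : K) + 2) * x (m + 1)
      + 2 * ((m : K) + 2) * ((m : K) + 1) ^ 4 * (2 * (m : K) + 1) * b0 ((m : K) + 2) * x m = 0) :
    SatisfiesRecursion x := by
  intro n hn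
  obtain ⟨m, rfl⟩ := Nat.exists_eq_add_of_le' hn
  have := h m
  have e1 : (m : K) + 2 - 1 = m + 1 := by ring
  have e2 : (m : K) + 2 + 1 = m + 3 := by ring
  have e3 : 2 * ((m : K) + 2) - 3 = 2 * m + 1 := by ring
  push_cast
  rw [e1, e2, e3]
  exact this

/-! ### Convergence, sign and a bound uniform in n for the series. -/

theorem summand_eq_term (n : ℕ) (t : ℝ) : summand n t = term n t := rfl

theorem term_natCast_eq_zero {n k : ℕ} (hk : k ≤ n) : term n (k : ℝ) = 0 := by
  have : ∏ j ∈ Finset.range (n + 1), ((k : ℝ) - (j : ℝ)) = 0 :=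
    Finset.prod_eq_zero (Finset.mem_range.2 (Nat.lt_succ_of_le hk)) (sub_self _)
  rw [term, this]
  simp

theorem term_neg {n : ℕ} {t : ℝ} (ht : (n : ℝ) < t) : term n t < 0 := by
  have hn : (0 : ℝ) ≤ n := n.cast_nonneg
  have h1 : 0 < ∏ j ∈ Finset.range (n + 1), (t - (j : ℝ)) := Finset.prod_pos fun j hj => by
    have : (j : ℝ) ≤ n := by exact_mod_cast Nat.lt_succ_iff.1 (Finset.mem_range.1 hj)
    linarith
  have h2 : 0 < ∏ j ∈ Finset.range (n + 1), (t + (n : ℝ) + (j : ℝ)) :=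
    Finset.prod_pos fun j _ => by have : (0 : ℝ) ≤ j := j.cast_nonneg; linarith
  have h3 : 0 < ∏ j ∈ Finset.range (n + 1), (t + (j : ℝ)) ^ 6 :=
    Finset.prod_pos fun j _ => by
      have : (0 : ℝ) ≤ j := j.cast_nonneg
      have : 0 < t + j := by linarith
      positivity
  have h4 : (0 : ℝ) < ((n ! : ℕ) : ℝ) := by exact_mod_cast n.factorial_pos
  have h5 : 0 < t + (n : ℝ) / 2 := by linarith
  rw [term, neg_mul, neg_mul, neg_div]
  exact neg_neg_of_pos (by positivity)

/-- The bound does not depend on n. Each factor (t - j)(t + n + j)/(t + j)⁶ is at most 2/(t + j)⁴;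
the n! ⁴ is spread over the factors with j ≥ 1, each of which becomes at most 1, and the factor j =
0 leaves 2/t⁴. -/
theorem abs_term_le_of_lt {n : ℕ} {t : ℝ} (ht : (n : ℝ) < t) : |term n t| ≤ 3 / t ^ 3 := by
  have hn : (0 : ℝ) ≤ n := n.cast_nonneg
  have t0 : 0 < t := by linarith
  have e : |term n t| = (t + (n : ℝ) / 2) * (∏ j ∈ Finset.range n, ((j : ℝ) + 1) ^ 4) *
      ∏ j ∈ Finset.range (n + 1), ((t - (j : ℝ)) * (t + (n : ℝ) + (j : ℝ)) / (t + (j : ℝ)) ^ 6) := by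
    rw [abs_of_neg (term_neg ht), term, Finset.prod_div_distrib, Finset.prod_mul_distrib,
      Finset.prod_pow (Finset.range n) 4, ← Finset.prod_range_add_one_eq_factorial]
    push_cast
    ring
  have b : ∏ j ∈ Finset.range (n + 1), ((t - (j : ℝ)) * (t + (n : ℝ) + (j : ℝ)) / (t + (j : ℝ)) ^ 6)
      ≤ ∏ j ∈ Finset.range (n + 1), (2 / (t + (j : ℝ)) ^ 4) := by
    refine Finset.prod_le_prod (fun j hj => ?_) fun j hj => ?_
    · have hj' : (j : ℝ) ≤ n := by exact_mod_cast Nat.lt_succ_iff.1 (Finset.mem_range.1 hj)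
      have : (0 : ℝ) ≤ j := j.cast_nonneg
      have : 0 ≤ t - j := by linarith
      positivity
    · have hj' : (j : ℝ) ≤ n := by exact_mod_cast Nat.lt_succ_iff.1 (Finset.mem_range.1 hj)
      have h0 : (0 : ℝ) ≤ j := j.cast_nonneg
      have hp : 0 < t + j := by linarith
      rw [div_le_div_iff₀ (by positivity) (by positivity)]
      have : (t - (j : ℝ)) * (t + (n : ℝ) + (j : ℝ)) ≤ (t + j) * (2 * (t + j)) :=
        mul_le_mul (by linarith) (by linarith) (by linarith) (by linarith)
      calc _ ≤ (t + j) * (2 * (t + j)) * (t + j) ^ 4 := by gcongr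
        _ = _ := by ring
  have b' : (∏ j ∈ Finset.range n, ((j : ℝ) + 1) ^ 4) *
      ∏ j ∈ Finset.range (n + 1), (2 / (t + (j : ℝ)) ^ 4) ≤ 2 / t ^ 4 := by
    rw [Finset.prod_range_succ', ← mul_assoc, ← Finset.prod_mul_distrib]
    push_cast
    rw [add_zero]
    have : ∏ j ∈ Finset.range n, (((j : ℝ) + 1) ^ 4 * (2 / (t + ((j : ℝ) + 1)) ^ 4)) ≤ 1 := by
      refine Finset.prod_le_one (fun j _ => by positivity) fun j hj => ?_
      have hj' : (j : ℝ) + 1 ≤ n := by exact_mod_cast Finset.mem_range.1 hj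
      have h0 : (0 : ℝ) ≤ j := j.cast_nonneg
      rw [← mul_div_assoc, div_le_one (by positivity)]
      -- Since j + 1 ≤ n < t, this gains a factor 16, which absorbs the 2.
      have : (2 * ((j : ℝ) + 1)) ^ 4 ≤ (t + ((j : ℝ) + 1)) ^ 4 := by gcongr; linarith
      nlinarith [pow_nonneg (show (0 : ℝ) ≤ j + 1 by linarith) 4]
    calc _ ≤ 1 * (2 / t ^ 4) := by gcongr
      _ = _ := one_mul _
  have hq : 0 ≤ ∏ j ∈ Finset.range n, ((j : ℝ) + 1) ^ 4 :=
    Finset.prod_nonneg fun j _ => by positivity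
  calc |term n t| ≤ (t + (n : ℝ) / 2) * (∏ j ∈ Finset.range n, ((j : ℝ) + 1) ^ 4) *
        ∏ j ∈ Finset.range (n + 1), (2 / (t + (j : ℝ)) ^ 4) := by
        rw [e]; gcongr
    _ ≤ (3 / 2 * t) * (2 / t ^ 4) := by
        rw [mul_assoc]
        exact mul_le_mul (by linarith) b'
          (mul_nonneg hq (Finset.prod_nonneg fun j _ => by positivity)) (by positivity)
    _ = 3 / t ^ 3 := by field_simp

theorem abs_term_natCast_le (n k : ℕ) :
    |term n ((k : ℝ) + 1)| ≤ 3 / ((k : ℝ) + 1) ^ 3 := by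
  rcases le_or_gt (k + 1) n with h | h
  · have := term_natCast_eq_zero h
    push_cast at this
    rw [this, abs_zero]
    positivity
  · exact abs_term_le_of_lt (by exact_mod_cast h)

theorem summable_bound : Summable fun k : ℕ => 3 / ((k : ℝ) + 1) ^ 3 := by
  have := (summable_nat_add_iff 1).2 (Real.summable_one_div_nat_pow.2 (show 1 < 3 by norm_num))
  refine (this.mul_left 3).congr fun k => ?_
  push_cast
  ring

theorem summable_term (n : ℕ) : Summable fun k : ℕ => term n ((k : ℝ) + 1) :=
  Summable.of_norm_bounded summable_bound fun k => by
    rw [Real.norm_eq_abs]; exact abs_term_natCast_le n k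

theorem hasSum_rt (n : ℕ) : HasSum (fun k : ℕ => term n ((k : ℝ) + 1)) (rt n) :=
  (summable_term n).hasSum

/-- Boundedness in n is the only analytic input that identifies `rt` as the decaying solution of the
recursion. -/
theorem abs_rt_le (n : ℕ) : |rt n| ≤ ∑' k : ℕ, 3 / ((k : ℝ) + 1) ^ 3 := by
  rw [← Real.norm_eq_abs]
  exact tsum_of_norm_bounded summable_bound.hasSum fun k => by
    rw [summand_eq_term, Real.norm_eq_abs]; exact abs_term_natCast_le n k

theorem rt_neg (n : ℕ) : rt n < 0 := by
  have h : ∀ k : ℕ, term n ((k : ℝ) + 1) ≤ 0 := fun k => by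
    rcases le_or_gt (k + 1) n with h | h
    · have := term_natCast_eq_zero h
      push_cast at this
      exact this.le
    · exact (term_neg (by exact_mod_cast h)).le
  have := (hasSum_rt n).neg.tsum_eq
  have hp : 0 < ∑' k : ℕ, -term n ((k : ℝ) + 1) :=
    (summable_term n).neg.tsum_pos (fun k => neg_nonneg.2 (h k)) n
      (neg_pos.2 (term_neg (by simp)))
  linarith

/-! ### Vanishing of the certificate at both ends and the recursion for the series. -/

section CertificateLimit

open Polynomial

section

variable {K L : Type*} [CommRing K] [CommRing L]

theorem map_certCoeff0 (f : K →+* L) (n : K) : f (certCoeff0 n) = certCoeff0 (f n) := by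
  simp only [certCoeff0, map_add, map_sub, map_mul, map_pow, map_ofNat]

theorem map_certCoeff1 (f : K →+* L) (n : K) : f (certCoeff1 n) = certCoeff1 (f n) := by
  simp only [certCoeff1, map_add, map_sub, map_mul, map_pow, map_ofNat]

theorem map_certCoeff2 (f : K →+* L) (n : K) : f (certCoeff2 n) = certCoeff2 (f n) := by
  simp only [certCoeff2, map_add, map_sub, map_mul, map_pow, map_ofNat]

theorem map_certCoeff3 (f : K →+* L) (n : K) : f (certCoeff3 n) = certCoeff3 (f n) := by
  simp only [certCoeff3, map_add, map_sub, map_mul, map_pow, map_ofNat]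

theorem map_certCoeff4 (f : K →+* L) (n : K) : f (certCoeff4 n) = certCoeff4 (f n) := by
  simp only [certCoeff4, map_add, map_sub, map_mul, map_pow, map_ofNat]

theorem map_certCoeff5 (f : K →+* L) (n : K) : f (certCoeff5 n) = certCoeff5 (f n) := by
  simp only [certCoeff5, map_add, map_sub, map_mul, map_pow, map_ofNat]

theorem map_certCoeff6 (f : K →+* L) (n : K) : f (certCoeff6 n) = certCoeff6 (f n) := by
  simp only [certCoeff6, map_add, map_sub, map_mul, map_pow, map_ofNat]

theorem map_certCoeff7 (f : K →+* L) (n : K) : f (certCoeff7 n) = certCoeff7 (f n) := by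
  simp only [certCoeff7, map_add, map_sub, map_mul, map_pow, map_neg, map_ofNat]

theorem map_certCoeff8 (f : K →+* L) (n : K) : f (certCoeff8 n) = certCoeff8 (f n) := by
  simp only [certCoeff8, map_add, map_sub, map_mul, map_pow, map_neg, map_ofNat]

theorem map_certCoeff9 (f : K →+* L) (n : K) : f (certCoeff9 n) = certCoeff9 (f n) := by
  simp only [certCoeff9, map_add, map_sub, map_mul, map_pow, map_neg, map_ofNat]

theorem map_certCoeff10 (f : K →+* L) (n : K) : f (certCoeff10 n) = certCoeff10 (f n) := by
  simp only [certCoeff10, map_add, map_sub, map_mul, map_pow, map_neg, map_ofNat]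

theorem map_certCoeff11 (f : K →+* L) (n : K) : f (certCoeff11 n) = certCoeff11 (f n) := by
  simp only [certCoeff11, map_add, map_sub, map_mul, map_pow, map_neg, map_ofNat]

theorem map_certCoeff12 (f : K →+* L) (n : K) : f (certCoeff12 n) = certCoeff12 (f n) := by
  simp only [certCoeff12, map_add, map_sub, map_mul, map_pow, map_ofNat]

theorem map_certCoeff13 (f : K →+* L) (n : K) : f (certCoeff13 n) = certCoeff13 (f n) := by
  simp only [certCoeff13, map_add, map_sub, map_mul, map_pow, map_ofNat]

theorem map_certCoeff14 (f : K →+* L) (n : K) : f (certCoeff14 n) = certCoeff14 (f n) := by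
  simp only [certCoeff14, map_add, map_sub, map_mul, map_pow, map_ofNat]

theorem map_certCoeff15 (f : K →+* L) (n : K) : f (certCoeff15 n) = certCoeff15 (f n) := by
  simp only [certCoeff15, map_add, map_sub, map_mul, map_pow, map_ofNat]

/-- Lets the certificate be evaluated through polynomial rings and through ℚ⟦ε⟧. -/
theorem map_certPoly (f : K →+* L) (n y : K) :
    f (certPoly n y) = certPoly (f n) (f y) := by
  simp only [certPoly, map_add, map_mul, map_pow,
    map_certCoeff0, map_certCoeff1, map_certCoeff2, map_certCoeff3, map_certCoeff4,
    map_certCoeff5, map_certCoeff6, map_certCoeff7, map_certCoeff8, map_certCoeff9,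
    map_certCoeff10, map_certCoeff11, map_certCoeff12, map_certCoeff13, map_certCoeff14,
    map_certCoeff15]

end

theorem natDegree_certPoly_le (n : ℝ) {y : ℝ[X]} (hy : y.natDegree ≤ 1) :
    (certPoly (C n) y).natDegree ≤ 15 := by
  have hc : ∀ k ≤ 15, ∀ c : ℝ, (C c * y ^ k).natDegree ≤ 15 := by
    intro k hk c
    refine (natDegree_C_mul_le _ _).trans ?_
    have : (y ^ k).natDegree ≤ k * 1 := natDegree_pow_le.trans (Nat.mul_le_mul_left k hy)
    omega
  obtain ⟨c, e⟩ : ∃ c : ℕ → ℝ, certPoly (C n) y = ∑ k ∈ Finset.range 16, C (c k) * y ^ k := by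
    refine ⟨fun k =>
      [certCoeff0 n, certCoeff1 n, certCoeff2 n, certCoeff3 n, certCoeff4 n, certCoeff5 n,
      certCoeff6 n, certCoeff7 n, certCoeff8 n, certCoeff9 n, certCoeff10 n, certCoeff11 n,
      certCoeff12 n, certCoeff13 n, certCoeff14 n, certCoeff15 n].getD k 0, ?_⟩
    rw [certPoly]
    simp only [Finset.sum_range_succ, Finset.sum_range_zero, List.getD_cons_zero,
      List.getD_cons_succ, pow_zero, pow_one, mul_one, zero_add]
    simp only [
    map_certCoeff0, map_certCoeff1, map_certCoeff2, map_certCoeff3, map_certCoeff4,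
    map_certCoeff5, map_certCoeff6, map_certCoeff7, map_certCoeff8, map_certCoeff9,
    map_certCoeff10, map_certCoeff11, map_certCoeff12, map_certCoeff13, map_certCoeff14,
    map_certCoeff15]
    ring
  rw [e]
  exact natDegree_sum_le_of_forall_le _ _ fun k hk =>
    hc k (Nat.lt_succ_iff.1 (Finset.mem_range.1 hk)) _

/-- Degree count: the numerator has degree at most 15 + (2m + 3), the denominator exactly 6(m + 3) +
2. -/
theorem tendsto_antidiff (m : ℕ) : Tendsto (fun t : ℝ => antidiff m t) atTop (𝓝 0) := by
  set N : ℝ[X] := C (((m ! : ℕ) : ℝ) ^ 4) * certPoly (C ((m : ℝ) + 2)) (X + C ((m : ℝ) + 2)) *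
    ((∏ j ∈ Finset.range (m + 2), (X - C (j : ℝ))) *
      ∏ j ∈ Finset.range (m + 1), (X + C ((m : ℝ) + (j : ℝ)))) with hN
  set D : ℝ[X] := C 2 * ((X + C (m : ℝ)) * (X + C ((m : ℝ) + 1)) *
    ∏ j ∈ Finset.range (m + 3), (X + C (j : ℝ)) ^ 6) with hD
  have h : ∀ t, antidiff m t = N.eval t / D.eval t := by
    intro t
    have hc : (certPoly (C ((m : ℝ) + 2)) (X + C ((m : ℝ) + 2))).eval t =
        certPoly ((m : ℝ) + 2) (t + m + 2) := by
      rw [← coe_evalRingHom, map_certPoly]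
      simp [add_assoc]
    simp only [hN, hD, eval_mul, eval_C, hc, eval_prod, eval_pow, eval_add, eval_sub, eval_X,
      antidiff, add_assoc, mul_assoc]
  simp_rw [h]
  refine div_tendsto_atTop_zero_of_degree_lt N D ?_
  have hDm : ((X + C (m : ℝ)) * (X + C ((m : ℝ) + 1)) *
      ∏ j ∈ Finset.range (m + 3), (X + C (j : ℝ)) ^ 6).Monic :=
    ((monic_X_add_C _).mul (monic_X_add_C _)).mul
      (monic_prod_of_monic _ _ fun j _ => (monic_X_add_C _).pow 6)
  have hDd : D.degree = ((6 * (m + 3) + 2 : ℕ) : WithBot ℕ) := by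
    rw [hD, degree_C_mul two_ne_zero, degree_eq_natDegree hDm.ne_zero]
    congr 1
    rw [((monic_X_add_C _).mul (monic_X_add_C _)).natDegree_mul
      (monic_prod_of_monic _ _ fun j _ => (monic_X_add_C _).pow 6),
      (monic_X_add_C _).natDegree_mul (monic_X_add_C _),
      natDegree_prod_of_monic _ _ fun j _ => (monic_X_add_C _).pow 6]
    simp only [natDegree_X_add_C, natDegree_pow, Finset.sum_const, Finset.card_range, smul_eq_mul]
    ring
  have hNd : N.natDegree ≤ 15 + ((m + 2) + (m + 1)) := by
    refine natDegree_mul_le.trans (add_le_add ?_ (natDegree_mul_le.trans (add_le_add ?_ ?_)))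
    · exact (natDegree_C_mul_le _ _).trans (natDegree_certPoly_le _ (natDegree_X_add_C _).le)
    · refine (natDegree_prod_le _ _).trans ?_
      simp only [natDegree_X_sub_C, Finset.sum_const, Finset.card_range, smul_eq_mul, mul_one,
        le_refl]
    · refine (natDegree_prod_le _ _).trans ?_
      simp only [natDegree_X_add_C, Finset.sum_const, Finset.card_range, smul_eq_mul, mul_one,
        le_refl]
  rw [hDd]
  exact degree_le_natDegree.trans_lt (by exact_mod_cast (by omega))

end CertificateLimit

theorem antidiff_one (m : ℕ) : antidiff m (1 : ℝ) = 0 := by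
  have : ∏ j ∈ Finset.range (m + 2), ((1 : ℝ) - (j : ℝ)) = 0 :=
    Finset.prod_eq_zero (i := 1) (Finset.mem_range.2 (by omega)) (by simp)
  rw [antidiff, this]
  simp

theorem rt_satisfiesRecursion : SatisfiesRecursion rt := by
  refine satisfiesRecursion_of_shift fun m => ?_
  have h := ((((hasSum_rt (m + 3)).mul_left
    (((m : ℝ) + 2) ^ 3 * ((m : ℝ) + 3) ^ 3 * b0 ((m : ℝ) + 1))).sub
    ((hasSum_rt (m + 2)).mul_left (2 * ((m : ℝ) + 2) * b1 ((m : ℝ) + 2)))).sub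
    ((hasSum_rt (m + 1)).mul_left (b2 ((m : ℝ) + 2)))).add
    ((hasSum_rt m).mul_left
      (2 * ((m : ℝ) + 2) * ((m : ℝ) + 1) ^ 4 * (2 * (m : ℝ) + 1) * b0 ((m : ℝ) + 2)))
  have h' := h.tendsto_sum_nat
  refine tendsto_nhds_unique h' ?_
  have e : ∀ k : ℕ, _ = _ := fun k => term_recursion (K := ℝ) two_ne_zero m ((k : ℝ) + 1)
    fun i => by positivity
  simp_rw [e]
  have e' : ∀ N : ℕ, ∑ k ∈ Finset.range N, (antidiff m ((k : ℝ) + 1 + 1) - antidiff m ((k : ℝ) + 1))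
      = antidiff m ((N : ℝ) + 1) := by
    intro N
    have := Finset.sum_range_sub (fun k : ℕ => antidiff m ((k : ℝ) + 1)) N
    push_cast at this
    rw [this, zero_add, antidiff_one, sub_zero]
  simp_rw [e']
  exact (tendsto_antidiff m).comp
    (tendsto_atTop_add_const_right _ _ tendsto_natCast_atTop_atTop)

/-! ### The recursion for the partial fraction coefficients, by Laurent expansion at the poles. -/

section Coefficients

open PowerSeries

theorem map_b0 {K L : Type*} [CommRing K] [CommRing L] (f : K →+* L) (n : K) :
    f (b0 n) = b0 (f n) := by
  simp only [b0, map_add, map_sub, map_mul, map_pow, map_ofNat]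

theorem map_b1 {K L : Type*} [CommRing K] [CommRing L] (f : K →+* L) (n : K) :
    f (b1 n) = b1 (f n) := by
  simp only [b1, map_add, map_sub, map_mul, map_pow, map_ofNat]

theorem map_b2 {K L : Type*} [CommRing K] [CommRing L] (f : K →+* L) (n : K) :
    f (b2 n) = b2 (f n) := by
  simp only [b2, map_add, map_sub, map_mul, map_pow, map_ofNat]

variable {K : Type*} [Field K] (f : PowerSeries ℚ →+* K)

/-- Membership in `f.range` encodes regularity at ε = 0. -/
theorem div_mem_range_of_constantCoeff_ne_zero {p q : PowerSeries ℚ}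
    (hq : constantCoeff q ≠ 0) : f p / f q ∈ f.range := by
  refine ⟨p * q⁻¹, ?_⟩
  have h : f q * f q⁻¹ = 1 := by rw [← map_mul, PowerSeries.mul_inv_cancel q hq, map_one]
  rw [map_mul, div_eq_mul_inv, eq_inv_of_mul_eq_one_right h]

theorem map_C_natCast (n : ℕ) : f (C (n : ℚ)) = n := by simp

theorem term_mem_range {c : ℚ} {n : ℕ} (hc : ∀ j ∈ Finset.range (n + 1), c + j ≠ 0) :
    term n (f (X + C c)) ∈ f.range := by
  have h := div_mem_range_of_constantCoeff_ne_zero f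
    (p := C (-((n ! : ℕ) : ℚ) ^ 4) * ((X + C c) + C ((n : ℚ) / 2)) *
      ((∏ j ∈ Finset.range (n + 1), ((X + C c) - C (j : ℚ))) *
        ∏ j ∈ Finset.range (n + 1), ((X + C c) + C (n : ℚ) + C (j : ℚ))))
    (q := ∏ j ∈ Finset.range (n + 1), ((X + C c) + C (j : ℚ)) ^ 6) (by
      simp only [map_prod, map_pow, map_add, constantCoeff_X, constantCoeff_C, zero_add]
      exact Finset.prod_ne_zero_iff.2 fun j hj => pow_ne_zero _ (hc j hj))
  have h2 : f (C ((n : ℚ) / 2)) = (n : K) / 2 := by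
    have := map_div₀ (f.comp C) (n : ℚ) 2
    rwa [map_natCast, map_ofNat] at this
  have h3 : f (C (-((n ! : ℕ) : ℚ) ^ 4)) = -((n ! : ℕ) : K) ^ 4 := by simp
  simp only [map_prod, map_mul, map_pow, map_add f (X + C c), map_add f (X + C c + _), map_sub,
    map_C_natCast, h2, h3] at h
  exact h

theorem antidiff_mem_range {c : ℚ} {m : ℕ} (hc : ∀ j : ℕ, j < m + 3 → c + j ≠ 0) :
    antidiff m (f (X + C c)) ∈ f.range := by
  have h := div_mem_range_of_constantCoeff_ne_zero f
    (p := C (((m ! : ℕ) : ℚ) ^ 4) * certPoly (C (m : ℚ) + 2) ((X + C c) + C (m : ℚ) + 2) *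
      ((∏ j ∈ Finset.range (m + 2), ((X + C c) - C (j : ℚ))) *
        ∏ j ∈ Finset.range (m + 1), ((X + C c) + C (m : ℚ) + C (j : ℚ))))
    (q := 2 * ((X + C c) + C (m : ℚ)) * ((X + C c) + C (m : ℚ) + 1) *
      ∏ j ∈ Finset.range (m + 3), ((X + C c) + C (j : ℚ)) ^ 6) (by
      simp only [map_prod, map_pow, map_mul, map_add, constantCoeff_X, constantCoeff_C, zero_add,
        map_ofNat, map_one]
      have h0 := hc m (by omega)
      have h1 := hc (m + 1) (by omega)
      push_cast at h1
      rw [← add_assoc] at h1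
      exact mul_ne_zero (mul_ne_zero (mul_ne_zero two_ne_zero h0) h1)
        (Finset.prod_ne_zero_iff.2 fun j hj => pow_ne_zero _ (hc j (Finset.mem_range.1 hj))))
  simp only [map_prod, map_mul, map_pow, map_add f (X + C c), map_add f (X + C c + _), map_sub,
    map_add f (C (m : ℚ)), map_certPoly, map_ofNat, map_one, map_C_natCast] at h
  exact h

/-- Identifies the formal expansion with ε⁶R(-j + ε). The embedding f is kept general so that ε ↦ -ε
can be composed with it in the symmetry argument. -/
theorem map_localExpansion (hf : Function.Injective f) {n j : ℕ} (hj : j ∈ Finset.range (n + 1)) :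
    f (localExpansion n j) = f X ^ 6 * term n (f (X + C (-(j : ℚ)))) := by
  have hX : f X ≠ 0 := (map_ne_zero_iff f hf).2 X_ne_zero
  set q : PowerSeries ℚ := ∏ i ∈ (Finset.range (n + 1)).erase j, (X + C ((i : ℚ) - (j : ℚ))) ^ 6
    with hq
  have hq0 : constantCoeff q ≠ 0 := by
    simp only [hq, map_prod, map_pow, map_add, constantCoeff_X, constantCoeff_C, zero_add]
    refine Finset.prod_ne_zero_iff.2 fun i hi => pow_ne_zero _ ?_
    rw [sub_ne_zero]
    exact_mod_cast (Finset.mem_erase.1 hi).1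
  have hqi : f q * f q⁻¹ = 1 := by rw [← map_mul, PowerSeries.mul_inv_cancel q hq0, map_one]
  have hsub : ∀ a b : ℚ, f (C (a - b)) = f (C a) - f (C b) := fun a b => by simp
  have hadd : ∀ a b : ℚ, f (C (a + b)) = f (C a) + f (C b) := fun a b => by simp
  have hneg : ∀ a : ℚ, f (C (-a)) = -f (C a) := fun a => by simp
  have h2 : f (C ((n : ℚ) / 2)) = (n : K) / 2 := by
    have := map_div₀ (f.comp C) (n : ℚ) 2
    rwa [map_natCast, map_ofNat] at this
  have h3 : f (C (((n ! : ℕ) : ℚ) ^ 4)) = ((n ! : ℕ) : K) ^ 4 := by simp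
  have hd : ∏ i ∈ Finset.range (n + 1), (f (X + C (-(j : ℚ))) + (i : K)) ^ 6 = f X ^ 6 * f q := by
    rw [← Finset.mul_prod_erase _ _ hj, hq, map_prod]
    congr 1
    · rw [map_add, hneg, map_C_natCast]; ring
    · refine Finset.prod_congr rfl fun i _ => ?_
      rw [map_pow, map_add, map_add, hneg, hsub, map_C_natCast, map_C_natCast]; ring
  rw [term, hd, localExpansion, ← hq, map_mul, eq_inv_of_mul_eq_one_right hqi]
  have hq' : f q ≠ 0 := left_ne_zero_of_mul_eq_one hqi
  rw [← mul_div_assoc, mul_div_mul_left _ _ (pow_ne_zero 6 hX), ← div_eq_mul_inv]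
  congr 1
  simp only [map_mul, map_prod, map_add f X, hsub, hadd, hneg, h2, h3, map_C_natCast]
  congr 1
  · congr 1; ring
  · congr 1
    · exact Finset.prod_congr rfl fun i _ => by ring
    · exact Finset.prod_congr rfl fun i _ => by ring

/-- The truncation at order six of the sum of `ε⁶ R(-j + ε)` over a range containing all poles. -/
theorem sum_term_eq (hf : Function.Injective f) {n N : ℕ} (hN : n < N) :
    ∃ g, ∑ j ∈ Finset.range N, f X ^ 6 * term n (f (X + C (-(j : ℚ)))) =
      f (∑ j ∈ Finset.range (n + 1), localExpansion n j + X ^ 6 * g) := by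
  have h : ∑ j ∈ Finset.Ico (n + 1) N, term n (f (X + C (-(j : ℚ)))) ∈ f.range :=
    Subring.sum_mem _ fun j hj => term_mem_range f fun i hi => by
      have h1 := (Finset.mem_Ico.1 hj).1
      have h2 := Finset.mem_range.1 hi
      rw [neg_add_eq_sub, sub_ne_zero]
      exact_mod_cast (h2.trans_le h1).ne
  obtain ⟨g, hg⟩ := h
  refine ⟨g, ?_⟩
  rw [map_add, map_mul, map_pow, hg, map_sum, ← Finset.sum_range_add_sum_Ico _ hN, Finset.mul_sum]
  congr 1
  exact Finset.sum_congr rfl fun j hj => (map_localExpansion f hf hj).symm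

theorem fractionRing_two_ne_zero : (2 : FractionRing (PowerSeries ℚ)) ≠ 0 := by
  have hf : Function.Injective (algebraMap (PowerSeries ℚ) (FractionRing (PowerSeries ℚ))) :=
    IsFractionRing.injective _ _
  rw [← map_ofNat (algebraMap (PowerSeries ℚ) (FractionRing (PowerSeries ℚ))) 2, Ne,
    map_eq_zero_iff _ hf, ← map_ofNat (C (R := ℚ)) 2, map_eq_zero_iff C PowerSeries.C_injective]
  norm_num

/-- The coefficient of ε^(6 - s) in the telescoped sum over j < m + 4, a range covering the poles of
all four summands. Non-poles and boundary values enter as multiples of ε⁶, hence invisibly since s ≥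
1. -/
theorem sum_pfCoeff_satisfiesRecursion {s : ℕ} (hs : 1 ≤ s) :
    SatisfiesRecursion fun n => ∑ j ∈ Finset.range (n + 1), pfCoeff n s j := by
  refine satisfiesRecursion_of_shift fun m => ?_
  set f := algebraMap (PowerSeries ℚ) (FractionRing (PowerSeries ℚ)) with hfdef
  have hf : Function.Injective f := IsFractionRing.injective _ _
  have hX : f X ≠ 0 := (map_ne_zero_iff f hf).2 X_ne_zero
  have h2 : (2 : FractionRing (PowerSeries ℚ)) ≠ 0 := fractionRing_two_ne_zero
  have hrec : ∀ j : ℕ, _ = _ := fun j => term_recursion h2 m (f (X + C (-(j : ℚ)))) fun k => by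
    rw [← map_C_natCast f k, ← map_add, Ne, map_eq_zero_iff f hf]
    intro h
    have := congrArg (coeff 1) h
    simp only [map_add, coeff_one_X, coeff_C, one_ne_zero, if_false, map_zero, add_zero] at this
  obtain ⟨g0, hg0⟩ := sum_term_eq f hf (n := m) (N := m + 4) (by omega)
  obtain ⟨g1, hg1⟩ := sum_term_eq f hf (n := m + 1) (N := m + 4) (by omega)
  obtain ⟨g2, hg2⟩ := sum_term_eq f hf (n := m + 2) (N := m + 4) (by omega)
  obtain ⟨g3, hg3⟩ := sum_term_eq f hf (n := m + 3) (N := m + 4) (by omega)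
  -- The boundary points ε + 1 and ε - (m + 3) lie just outside the poles 0, -1, …, -(m + 2) of the
  -- certificate.
  obtain ⟨e0, he0⟩ := antidiff_mem_range f (c := 1) (m := m) fun j _ => by positivity
  obtain ⟨e1, he1⟩ := antidiff_mem_range f (c := 1 - (m + 4 : ℕ)) (m := m) fun j hj => by
    have : (j : ℚ) < m + 3 := by exact_mod_cast hj
    push_cast
    intro h
    linarith
  have htel : ∑ j ∈ Finset.range (m + 4),
      (antidiff m (f (X + C (-(j : ℚ))) + 1) - antidiff m (f (X + C (-(j : ℚ))))) = f (e0 - e1) := by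
    have := Finset.sum_range_sub' (fun j : ℕ => antidiff m (f (X + C (1 - (j : ℚ))))) (m + 4)
    rw [map_sub, he0, he1]
    simp only [Nat.cast_zero, sub_zero] at this
    rw [← this]
    refine Finset.sum_congr rfl fun j _ => ?_
    congr 2
    · rw [← map_one f, ← map_add, sub_eq_add_neg, map_add C, map_one]
      congr 1; ring
    · push_cast
      congr 3; ring
  have hsum := congrArg (f X ^ 6 * ·) htel
  simp only [← hrec] at hsum
  set c3 : ℚ := ((m : ℚ) + 2) ^ 3 * ((m : ℚ) + 3) ^ 3 * b0 ((m : ℚ) + 1)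
  set c2 : ℚ := 2 * ((m : ℚ) + 2) * b1 ((m : ℚ) + 2)
  set c1 : ℚ := b2 ((m : ℚ) + 2)
  set c0 : ℚ := 2 * ((m : ℚ) + 2) * ((m : ℚ) + 1) ^ 4 * (2 * (m : ℚ) + 1) * b0 ((m : ℚ) + 2)
  set μ : FractionRing (PowerSeries ℚ) := (m : FractionRing (PowerSeries ℚ)) with hμ
  have k0 : f (C c0) = 2 * (μ + 2) * (μ + 1) ^ 4 *
      (2 * μ + 1) * b0 (μ + 2) := by
    simp only [hμ, c0, map_mul, map_pow, map_add, map_b0, map_C_natCast, map_ofNat, map_one]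
  have k1 : f (C c1) = b2 (μ + 2) := by
    simp only [hμ, c1, map_add, map_b2, map_C_natCast, map_ofNat]
  have k2 : f (C c2) = 2 * (μ + 2) * b1 (μ + 2) := by
    simp only [hμ, c2, map_mul, map_add, map_b1, map_C_natCast, map_ofNat]
  have k3 : f (C c3) = (μ + 2) ^ 3 * (μ + 3) ^ 3 *
      b0 (μ + 1) := by
    simp only [hμ, c3, map_mul, map_pow, map_add, map_b0, map_C_natCast, map_ofNat, map_one]
  have key : f (C c3 * (∑ j ∈ Finset.range (m + 3 + 1), localExpansion (m + 3) j + X ^ 6 * g3)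
      - C c2 * (∑ j ∈ Finset.range (m + 2 + 1), localExpansion (m + 2) j + X ^ 6 * g2)
      - C c1 * (∑ j ∈ Finset.range (m + 1 + 1), localExpansion (m + 1) j + X ^ 6 * g1)
      + C c0 * (∑ j ∈ Finset.range (m + 1), localExpansion m j + X ^ 6 * g0)) =
      f (X ^ 6 * (e0 - e1)) := by
    generalize ∑ j ∈ Finset.range (m + 3 + 1), localExpansion (m + 3) j + X ^ 6 * g3 = S3 at *
    generalize ∑ j ∈ Finset.range (m + 2 + 1), localExpansion (m + 2) j + X ^ 6 * g2 = S2 at *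
    generalize ∑ j ∈ Finset.range (m + 1 + 1), localExpansion (m + 1) j + X ^ 6 * g1 = S1 at *
    generalize ∑ j ∈ Finset.range (m + 1), localExpansion m j + X ^ 6 * g0 = S0 at *
    rw [map_mul f (X ^ 6), map_pow, ← hsum]
    simp only [map_add, map_sub, map_mul, ← hg0, ← hg1, ← hg2, ← hg3, k0, k1, k2, k3,
      Finset.mul_sum]
    rw [← Finset.sum_sub_distrib, ← Finset.sum_sub_distrib, ← Finset.sum_add_distrib]
    exact Finset.sum_congr rfl fun j _ => by ring
  have hc := congrArg (coeff (6 - s)) (hf key)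
  have hlt : 6 - s < 6 := by omega
  have hX6 : ∀ g : PowerSeries ℚ, coeff (6 - s) (X ^ 6 * g) = 0 := fun g => by
    rw [coeff_X_pow_mul', if_neg (by omega)]
  simp only [map_add, map_sub, coeff_C_mul, hX6, map_sum, add_zero] at hc
  exact hc

end Coefficients

/-! ### The well-poised symmetry t ↦ -n - t. -/

section Symmetry

theorem term_reflect {K : Type*} [Field K] (h2 : (2 : K) ≠ 0) (n : ℕ) (t : K) :
    term n (-n - t) = -term n t := by
  have h1 : ∏ j ∈ Finset.range (n + 1), (-(n : K) - t - (j : K)) =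
      (-1) ^ (n + 1) * ∏ j ∈ Finset.range (n + 1), (t + (n : K) + (j : K)) := by
    rw [← Finset.card_range (n + 1), ← Finset.prod_const, Finset.card_range,
      ← Finset.prod_mul_distrib]
    exact Finset.prod_congr rfl fun j _ => by ring
  have h3 : ∏ j ∈ Finset.range (n + 1), (-(n : K) - t + (n : K) + (j : K)) =
      (-1) ^ (n + 1) * ∏ j ∈ Finset.range (n + 1), (t - (j : K)) := by
    rw [← Finset.card_range (n + 1), ← Finset.prod_const, Finset.card_range,
      ← Finset.prod_mul_distrib]
    exact Finset.prod_congr rfl fun j _ => by ring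
  have h4 : ∏ j ∈ Finset.range (n + 1), (-(n : K) - t + (j : K)) ^ 6 =
      ∏ j ∈ Finset.range (n + 1), (t + (j : K)) ^ 6 := by
    rw [← Finset.prod_range_reflect]
    refine Finset.prod_congr rfl fun j hj => ?_
    have : j ≤ n := Nat.lt_succ_iff.1 (Finset.mem_range.1 hj)
    rw [show n + 1 - 1 - j = n - j by omega, Nat.cast_sub this]
    ring
  have h5 : -(n : K) - t + (n : K) / 2 = -(t + (n : K) / 2) := by
    field_simp
    ring
  have h6 : ((-1 : K) ^ (n + 1)) * (-1) ^ (n + 1) = 1 := by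
    rw [← mul_pow]; simp
  rw [term, term, h1, h3, h4, h5]
  linear_combination ((n ! : ℕ) : K) ^ 4 * (t + (n : K) / 2) *
    (∏ j ∈ Finset.range (n + 1), (t + (n : K) + (j : K))) *
    (∏ j ∈ Finset.range (n + 1), (t - (j : K))) / (∏ j ∈ Finset.range (n + 1), (t + (j : K)) ^ 6)
    * h6

open PowerSeries

/-- The reflection sends -j + ε to -(n - j) - ε, so it exchanges the poles j and n - j and reverses
ε. -/
theorem rescale_localExpansion {n j : ℕ} (hj : j ∈ Finset.range (n + 1)) :
    rescale (-1) (localExpansion n (n - j)) = -localExpansion n j := by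
  set f := algebraMap (PowerSeries ℚ) (FractionRing (PowerSeries ℚ)) with hfdef
  have hf : Function.Injective f := IsFractionRing.injective _ _
  have hr : Function.Injective (rescale (-1 : ℚ)) := fun p q h => by
    have := congrArg (rescale (-1 : ℚ)) h
    simpa [rescale_rescale] using this
  have h2 : (2 : FractionRing (PowerSeries ℚ)) ≠ 0 := fractionRing_two_ne_zero
  have hjn : j ≤ n := Nat.lt_succ_iff.1 (Finset.mem_range.1 hj)
  have h := map_localExpansion (f.comp (rescale (-1))) (hf.comp hr) (n := n) (j := n - j)
    (Finset.mem_range.2 (by omega))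
  apply hf
  rw [map_neg, map_localExpansion f hf hj, ← RingHom.comp_apply, h, ← mul_neg, ← term_reflect h2]
  have e1 : (f.comp (rescale (-1))) X = -f X := by simp [rescale_X]
  have e2 : (f.comp (rescale (-1))) (X + PowerSeries.C (-((n - j : ℕ) : ℚ))) =
      -n - f (X + PowerSeries.C (-(j : ℚ))) := by
    rw [map_add, e1, Nat.cast_sub hjn]
    simp
    ring
  rw [e1, e2, neg_pow]
  norm_num

theorem pfCoeff_reflect {n j s : ℕ} (hs : s ≤ 6) (hj : j ∈ Finset.range (n + 1)) :
    (-1) ^ s * pfCoeff n s (n - j) = -pfCoeff n s j := by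
  have h := congrArg (coeff (6 - s)) (rescale_localExpansion hj)
  rw [coeff_rescale, map_neg] at h
  have e : (-1 : ℚ) ^ (6 - s) = (-1) ^ s := by
    interval_cases s <;> norm_num
  rw [pfCoeff, pfCoeff, ← h, e]

theorem sum_pfCoeff_even {n s : ℕ} (hs : s ≤ 6) (he : Even s) :
    ∑ j ∈ Finset.range (n + 1), pfCoeff n s j = 0 := by
  have h : ∑ j ∈ Finset.range (n + 1), pfCoeff n s (n - j) =
      ∑ j ∈ Finset.range (n + 1), pfCoeff n s j := by
    rw [← Finset.sum_range_reflect]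
    refine Finset.sum_congr rfl fun j hj => ?_
    have : j ≤ n := Nat.lt_succ_iff.1 (Finset.mem_range.1 hj)
    rw [show n - (n + 1 - 1 - j) = j by omega]
  have h' : ∑ j ∈ Finset.range (n + 1), pfCoeff n s (n - j) =
      -∑ j ∈ Finset.range (n + 1), pfCoeff n s j := by
    rw [← Finset.sum_neg_distrib]
    refine Finset.sum_congr rfl fun j hj => ?_
    rw [← pfCoeff_reflect hs hj, he.neg_one_pow, one_mul]
  linarith

end Symmetry

/-! ### The formal local coefficients give the actual partial fraction expansion. -/

section PartialFractions

open Polynomial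

/-- The numerator of the summand. -/
noncomputable def numerator (n : ℕ) : ℚ[X] :=
  C (-((n ! : ℕ) : ℚ) ^ 4) * (X + C ((n : ℚ) / 2)) *
    ((∏ i ∈ Finset.range (n + 1), (X - C (i : ℚ))) *
      ∏ i ∈ Finset.range (n + 1), (X + C ((n : ℚ) + (i : ℚ))))

/-- The product of the factors of the denominator other than `(t + j)⁶`. -/
noncomputable def codenominator (n j : ℕ) : ℚ[X] :=
  ∏ i ∈ (Finset.range (n + 1)).erase j, (X + C (i : ℚ)) ^ 6

/-- The numerator of the partial fraction expansion. -/
noncomputable def expansionNumerator (n : ℕ) : ℚ[X] :=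
  ∑ s ∈ Finset.Icc 1 6, ∑ j ∈ Finset.range (n + 1),
    C (pfCoeff n s j) * (X + C (j : ℚ)) ^ (6 - s) * codenominator n j

/-- Expansion of a polynomial around `-j`, as a power series. -/
noncomputable def expandAt (j : ℕ) : ℚ[X] →+* PowerSeries ℚ :=
  eval₂RingHom PowerSeries.C (PowerSeries.X + PowerSeries.C (-(j : ℚ)))

theorem expandAt_X (j : ℕ) : expandAt j X = PowerSeries.X + PowerSeries.C (-(j : ℚ)) := by
  simp [expandAt]

theorem expandAt_C (j : ℕ) (c : ℚ) : expandAt j (C c) = PowerSeries.C c := by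
  simp [expandAt]

theorem X_add_C_pow_dvd {j : ℕ} {k : ℕ} {p : ℚ[X]} (h : PowerSeries.X ^ k ∣ expandAt j p) :
    (X + C (j : ℚ)) ^ k ∣ p := by
  have e : expandAt j p = ((p.comp (X + C (-(j : ℚ))) : ℚ[X]) : PowerSeries ℚ) := by
    have : expandAt j = Polynomial.coeToPowerSeries.ringHom.comp
        (compRingHom (X + C (-(j : ℚ)))) := by
      refine Polynomial.ringHom_ext (fun a => ?_) ?_
      · simp [expandAt]
      · simp only [expandAt, coe_eval₂RingHom, eval₂_X, RingHom.comp_apply, coe_compRingHom,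
          X_comp, map_add, coeToPowerSeries.ringHom_apply, coe_X, coe_C]
    rw [this]
    rfl
  have h' : X ^ k ∣ p.comp (X + C (-(j : ℚ))) := by
    rw [X_pow_dvd_iff]
    intro d hd
    rw [e, PowerSeries.X_pow_dvd_iff] at h
    rw [← Polynomial.coeff_coe]
    exact h d hd
  rw [← X_sub_C_pow_dvd_iff] at h'
  simpa using h'

theorem expandAt_X_add_C (j : ℕ) (c : ℚ) :
    expandAt j (X + C c) = PowerSeries.X + PowerSeries.C (c - (j : ℚ)) := by
  rw [map_add, expandAt_X, expandAt_C, add_assoc, ← map_add, neg_add_eq_sub]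

theorem expandAt_numerator (n j : ℕ) :
    expandAt j (numerator n) = localExpansion n j * expandAt j (codenominator n j) := by
  have h1 : expandAt j (codenominator n j) = ∏ i ∈ (Finset.range (n + 1)).erase j,
      (PowerSeries.X + PowerSeries.C ((i : ℚ) - (j : ℚ))) ^ 6 := by
    simp only [codenominator, map_prod, map_pow, expandAt_X_add_C]
  have h2 : PowerSeries.constantCoeff (∏ i ∈ (Finset.range (n + 1)).erase j,
      (PowerSeries.X + PowerSeries.C ((i : ℚ) - (j : ℚ))) ^ 6) ≠ 0 := by
    simp only [map_prod, map_pow, map_add, PowerSeries.constantCoeff_X,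
      PowerSeries.constantCoeff_C, zero_add]
    refine Finset.prod_ne_zero_iff.2 fun i hi => pow_ne_zero _ ?_
    rw [sub_ne_zero]
    exact_mod_cast (Finset.mem_erase.1 hi).1
  rw [h1, localExpansion, mul_assoc, PowerSeries.inv_mul_cancel _ h2, mul_one, numerator]
  simp only [map_mul, map_prod, expandAt_C, expandAt_X_add_C, sub_eq_add_neg, ← C_neg,
    add_comm (-(j : ℚ))]

theorem X_pow_dvd_sub_sum (p : PowerSeries ℚ) : PowerSeries.X ^ 6 ∣
    p - ∑ s ∈ Finset.Icc 1 6, PowerSeries.C (PowerSeries.coeff (6 - s) p) *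
      PowerSeries.X ^ (6 - s) := by
  rw [PowerSeries.X_pow_dvd_iff]
  intro d hd
  rw [map_sub, map_sum, sub_eq_zero, Finset.sum_eq_single (6 - d)]
  · rw [show 6 - (6 - d) = d by omega]; simp
  · intro s hs hne
    have := Finset.mem_Icc.1 hs
    rw [PowerSeries.coeff_C_mul, PowerSeries.coeff_X_pow, if_neg (by omega), mul_zero]
  · intro h
    exact absurd (Finset.mem_Icc.2 (by omega)) h

/-- Near -j the terms at pole j reproduce the local expansion modulo ε⁶, and every other term
contains (t + j)⁶ through its `codenominator`. -/
theorem X_add_C_pow_dvd_sub (n : ℕ) {j : ℕ} (hj : j ∈ Finset.range (n + 1)) :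
    (X + C (j : ℚ)) ^ 6 ∣ numerator n - expansionNumerator n := by
  apply X_add_C_pow_dvd
  have h : expandAt j (numerator n - expansionNumerator n) =
      (localExpansion n j - ∑ s ∈ Finset.Icc 1 6, PowerSeries.C (PowerSeries.coeff (6 - s)
        (localExpansion n j)) * PowerSeries.X ^ (6 - s)) * expandAt j (codenominator n j) -
      ∑ s ∈ Finset.Icc 1 6, ∑ i ∈ (Finset.range (n + 1)).erase j,
        expandAt j (C (pfCoeff n s i) * (X + C (i : ℚ)) ^ (6 - s) * codenominator n i) := by
    rw [map_sub, expandAt_numerator, sub_mul, sub_sub]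
    congr 1
    rw [expansionNumerator, map_sum, Finset.sum_mul, ← Finset.sum_add_distrib]
    refine Finset.sum_congr rfl fun s _ => ?_
    rw [map_sum, ← Finset.add_sum_erase _ _ hj]
    congr 1
    rw [map_mul, map_mul, map_pow, expandAt_X_add_C, expandAt_C, sub_self, map_zero, add_zero]
    rfl
  rw [h]
  refine dvd_sub (Dvd.dvd.mul_right (X_pow_dvd_sub_sum _) _)
    (Finset.dvd_sum fun s _ => Finset.dvd_sum fun i hi => ?_)
  rw [map_mul]
  refine Dvd.dvd.mul_left ?_ _
  have hji : j ∈ (Finset.range (n + 1)).erase i :=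
    Finset.mem_erase.2 ⟨fun h => (Finset.mem_erase.1 hi).1 h.symm, hj⟩
  rw [codenominator, ← Finset.mul_prod_erase _ _ hji, map_mul, map_pow, expandAt_X_add_C, sub_self,
    map_zero, add_zero]
  exact dvd_mul_right _ _

theorem degree_numerator_lt (n : ℕ) : (numerator n).degree < ((6 * (n + 1) : ℕ) : WithBot ℕ) := by
  have h : (numerator n).natDegree ≤ 1 + ((n + 1) + (n + 1)) := by
    refine natDegree_mul_le.trans (add_le_add ?_ (natDegree_mul_le.trans (add_le_add ?_ ?_)))
    · exact (natDegree_C_mul_le _ _).trans (natDegree_X_add_C _).le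
    · refine (natDegree_prod_le _ _).trans ?_
      simp only [natDegree_X_sub_C, Finset.sum_const, Finset.card_range, smul_eq_mul, mul_one,
        le_refl]
    · refine (natDegree_prod_le _ _).trans ?_
      simp only [natDegree_X_add_C, Finset.sum_const, Finset.card_range, smul_eq_mul, mul_one,
        le_refl]
  exact degree_le_natDegree.trans_lt (by exact_mod_cast (by omega))

theorem degree_expansionNumerator_lt (n : ℕ) :
    (expansionNumerator n).degree < ((6 * (n + 1) : ℕ) : WithBot ℕ) := by
  have h : (expansionNumerator n).natDegree ≤ 5 + 6 * n := by
    refine natDegree_sum_le_of_forall_le _ _ fun s hs =>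
      natDegree_sum_le_of_forall_le _ _ fun j hj => ?_
    have hs' := Finset.mem_Icc.1 hs
    refine natDegree_mul_le.trans (add_le_add ((natDegree_C_mul_le _ _).trans ?_) ?_)
    · rw [natDegree_pow, natDegree_X_add_C]
      omega
    · refine (natDegree_prod_le _ _).trans ?_
      simp only [natDegree_pow, natDegree_X_add_C, Finset.sum_const, Finset.card_erase_of_mem hj,
        Finset.card_range, smul_eq_mul]
      omega
  exact degree_le_natDegree.trans_lt (by exact_mod_cast (by omega))

/-- The difference is divisible by the pairwise coprime (X + j)⁶, hence by a product of degree 6(n +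
1), but has smaller degree. -/
theorem numerator_eq (n : ℕ) : numerator n = expansionNumerator n := by
  have hd : ∏ j ∈ Finset.range (n + 1), (X + C (j : ℚ)) ^ 6 ∣
      numerator n - expansionNumerator n := by
    refine Finset.prod_dvd_of_coprime ?_ fun j hj => X_add_C_pow_dvd_sub n hj
    intro i _ j _ hij
    refine IsCoprime.pow ?_
    have := isCoprime_X_sub_C_of_isUnit_sub (R := ℚ) (a := -i) (b := -j) (by
      rw [isUnit_iff_ne_zero, neg_sub_neg, sub_ne_zero]
      exact_mod_cast hij.symm)
    simpa using this
  have hm : (∏ j ∈ Finset.range (n + 1), (X + C (j : ℚ)) ^ 6).Monic :=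
    monic_prod_of_monic _ _ fun j _ => (monic_X_add_C _).pow 6
  have hdeg : (∏ j ∈ Finset.range (n + 1), (X + C (j : ℚ)) ^ 6).degree =
      ((6 * (n + 1) : ℕ) : WithBot ℕ) := by
    rw [degree_eq_natDegree hm.ne_zero,
      natDegree_prod_of_monic _ _ fun j _ => (monic_X_add_C _).pow 6]
    simp only [natDegree_X_add_C, natDegree_pow, Finset.sum_const, Finset.card_range, smul_eq_mul]
    congr 1
    ring
  rw [← sub_eq_zero]
  by_contra hne
  refine hm.not_dvd_of_degree_lt hne ?_ hd
  rw [hdeg]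
  exact (degree_sub_le _ _).trans_lt
    (max_lt (degree_numerator_lt n) (degree_expansionNumerator_lt n))

theorem term_eq_partialFractions (n : ℕ) {t : ℝ} (ht : 0 < t) :
    term n t = ∑ s ∈ Finset.Icc 1 6, ∑ j ∈ Finset.range (n + 1),
      (pfCoeff n s j : ℝ) / (t + j) ^ s := by
  have h := congrArg (aeval t) (numerator_eq n)
  have hpos : ∀ j : ℕ, 0 < t + j := fun j => by positivity
  have hD : ∏ j ∈ Finset.range (n + 1), (t + (j : ℝ)) ^ 6 ≠ 0 :=
    Finset.prod_ne_zero_iff.2 fun j _ => (pow_pos (hpos j) 6).ne'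
  have hl : aeval t (numerator n) = -((n ! : ℕ) : ℝ) ^ 4 * (t + (n : ℝ) / 2) *
      ((∏ j ∈ Finset.range (n + 1), (t - (j : ℝ))) *
      ∏ j ∈ Finset.range (n + 1), (t + (n : ℝ) + (j : ℝ))) := by
    simp [numerator, map_prod, add_assoc]
  rw [term, ← hl, h, div_eq_iff hD, expansionNumerator, map_sum, Finset.sum_mul]
  refine Finset.sum_congr rfl fun s hs => ?_
  rw [map_sum, Finset.sum_mul]
  refine Finset.sum_congr rfl fun j hj => ?_
  have hs' := Finset.mem_Icc.1 hs
  have hc : aeval t (codenominator n j) =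
      ∏ i ∈ (Finset.range (n + 1)).erase j, (t + (i : ℝ)) ^ 6 := by
    simp [codenominator, map_prod]
  have hp : (t + (j : ℝ)) ^ 6 = (t + (j : ℝ)) ^ (6 - s) * (t + (j : ℝ)) ^ s := by
    rw [← pow_add]; congr 1; omega
  rw [← Finset.mul_prod_erase _ _ hj, ← hc, hp]
  have := (hpos j).ne'
  simp only [map_mul, map_pow, map_add, aeval_X, aeval_C, eq_ratCast, Rat.cast_natCast]
  field_simp

end PartialFractions

/-! ### The linear form in ζ(5), ζ(3) and 1. -/

section LinearForm

theorem tendsto_mul_one_div_add_pow (j s : ℕ) :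
    Tendsto (fun t : ℝ => t * (1 / (t + j) ^ (s + 1))) atTop (𝓝 (if s = 0 then 1 else 0)) := by
  have hinv : Tendsto (fun t : ℝ => (t + j)⁻¹) atTop (𝓝 0) :=
    tendsto_inv_atTop_zero.comp (tendsto_atTop_add_const_right _ _ tendsto_id)
  have h1 : Tendsto (fun t : ℝ => 1 - j * (t + j)⁻¹) atTop (𝓝 1) := by
    simpa using (hinv.const_mul (j : ℝ)).const_sub 1
  have h2 : Tendsto (fun t : ℝ => (1 - j * (t + j)⁻¹) * (t + j)⁻¹ ^ s) atTop
      (𝓝 (if s = 0 then 1 else 0)) := by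
    have := h1.mul (hinv.pow s)
    rwa [one_mul, zero_pow_eq] at this
  refine h2.congr' ?_
  filter_upwards [eventually_gt_atTop 0] with t ht
  have : t + (j : ℝ) ≠ 0 := by positivity
  rw [pow_succ, inv_pow]
  field_simp
  ring

/-- The sum of residues is the limit of tR(t) at infinity, which is 0 because R(t) = O(t⁻³). -/
theorem sum_pfCoeff_one (n : ℕ) : ∑ j ∈ Finset.range (n + 1), pfCoeff n 1 j = 0 := by
  have h1 : Tendsto (fun t : ℝ => t * term n t) atTop (𝓝 0) := by
    have h3 : Tendsto (fun t : ℝ => 3 * t⁻¹ ^ 2) atTop (𝓝 0) := by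
      simpa using (tendsto_inv_atTop_zero.pow 2).const_mul (3 : ℝ)
    refine squeeze_zero_norm' ?_ h3
    filter_upwards [eventually_gt_atTop (n : ℝ), eventually_gt_atTop 0] with t ht ht0
    rw [norm_mul, Real.norm_eq_abs, Real.norm_eq_abs, abs_of_pos ht0]
    calc t * |term n t| ≤ t * (3 / t ^ 3) := by gcongr; exact abs_term_le_of_lt ht
      _ = 3 * t⁻¹ ^ 2 := by field_simp
  have h2 : Tendsto (fun t : ℝ => t * term n t) atTop
      (𝓝 (∑ s ∈ Finset.Icc 1 6, ∑ j ∈ Finset.range (n + 1),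
        (pfCoeff n s j : ℝ) * if s - 1 = 0 then 1 else 0)) := by
    have := tendsto_finsetSum (Finset.Icc 1 6) fun s _ =>
      tendsto_finsetSum (Finset.range (n + 1)) fun j _ =>
        (tendsto_mul_one_div_add_pow j (s - 1)).const_mul (pfCoeff n s j : ℝ)
    refine this.congr' ?_
    filter_upwards [eventually_gt_atTop 0] with t ht
    rw [term_eq_partialFractions n ht, Finset.mul_sum]
    refine Finset.sum_congr rfl fun s hs => ?_
    rw [Finset.mul_sum]
    refine Finset.sum_congr rfl fun j _ => ?_
    rw [Nat.sub_add_cancel (Finset.mem_Icc.1 hs).1]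
    ring
  have h := tendsto_nhds_unique h1 h2
  rw [Finset.sum_eq_single 1] at h
  · simp only [Nat.sub_self, if_true, mul_one] at h
    exact_mod_cast h.symm
  · intro s hs hne
    have := (Finset.mem_Icc.1 hs).1
    rw [if_neg (by omega)]
    simp
  · simp

/-- Partial sums of the zeta series. -/
noncomputable def harmonicSum (s N : ℕ) : ℝ := ∑ l ∈ Finset.Icc 1 N, 1 / (l : ℝ) ^ s

theorem harmonicSum_succ (s N : ℕ) :
    harmonicSum s (N + 1) = harmonicSum s N + 1 / ((N : ℝ) + 1) ^ s := by
  rw [harmonicSum, Finset.sum_Icc_succ_top (by omega), harmonicSum]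
  push_cast
  rfl

theorem sum_range_one_div_pow (s j N : ℕ) :
    ∑ k ∈ Finset.range N, 1 / ((k : ℝ) + 1 + j) ^ s = harmonicSum s (N + j) - harmonicSum s j := by
  induction N with
  | zero => simp
  | succ N ih =>
    rw [Finset.sum_range_succ, ih, show N + 1 + j = N + j + 1 by ring, harmonicSum_succ]
    push_cast
    ring

theorem tendsto_harmonicSum {s : ℕ} (hs : 1 < s) :
    Tendsto (harmonicSum s) atTop (𝓝 (∑' n : ℕ, 1 / (n : ℝ) ^ s)) := by
  have h := (Real.summable_one_div_nat_pow.2 hs).hasSum.tendsto_sum_nat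
  refine (h.comp (tendsto_add_atTop_nat 1)).congr fun N => ?_
  rw [Function.comp, harmonicSum, Finset.sum_range_succ', Finset.range_eq_Ico,
    Finset.sum_Ico_add' (fun k : ℕ => 1 / (k : ℝ) ^ s) 0 N 1]
  -- The term of index 0 is `1 / 0 ^ s = 0`, so the series effectively starts at 1.
  simp [zero_pow (by omega : s ≠ 0)]
  rfl

theorem tendsto_harmonicSum_one_sub (j : ℕ) :
    Tendsto (fun N => harmonicSum 1 (N + j) - harmonicSum 1 N) atTop (𝓝 0) := by
  induction j with
  | zero => simp
  | succ j ih =>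
    have h : Tendsto (fun N : ℕ => 1 / (((N + j : ℕ) : ℝ) + 1) ^ 1) atTop (𝓝 0) := by
      simp only [pow_one]
      exact tendsto_one_div_add_atTop_nhds_zero_nat.comp (tendsto_add_atTop_nat j)
    have := ih.add h
    rw [add_zero] at this
    refine this.congr fun N => ?_
    rw [← add_assoc, harmonicSum_succ]
    ring

/-- The value at `s` of the zeta series, with `0` in place of the divergent series. -/
noncomputable def zetaSum (s : ℕ) : ℝ := if s = 1 then 0 else ∑' n : ℕ, 1 / (n : ℝ) ^ s

theorem riemannZeta_eq_zetaSum {s : ℕ} (hs : 1 < s) : riemannZeta s = (zetaSum s : ℂ) := by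
  rw [zetaSum, if_neg hs.ne', zeta_nat_eq_tsum_of_gt_one hs, Complex.ofReal_tsum]
  push_cast
  rfl

/-- For s = 1 the harmonic series diverges, but its divergent part is independent of j in the limit
and is multiplied by ∑_j A_{1,j} = 0; this is why `zetaSum 1` may be set to 0. -/
theorem tendsto_pfCoeff_sum (n : ℕ) {s : ℕ} (hs : 1 ≤ s) :
    Tendsto (fun N => ∑ j ∈ Finset.range (n + 1), (pfCoeff n s j : ℝ) *
      ∑ k ∈ Finset.range N, 1 / ((k : ℝ) + 1 + j) ^ s) atTop
      (𝓝 (∑ j ∈ Finset.range (n + 1), (pfCoeff n s j : ℝ) * (zetaSum s - harmonicSum s j))) := by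
  simp_rw [sum_range_one_div_pow]
  rcases hs.eq_or_lt with rfl | hs
  · have h := tendsto_finsetSum (Finset.range (n + 1)) fun j _ =>
      ((tendsto_harmonicSum_one_sub j).sub_const (harmonicSum 1 j)).const_mul (pfCoeff n 1 j : ℝ)
    have hz : zetaSum 1 = 0 := if_pos rfl
    rw [hz]
    refine h.congr fun N => ?_
    have h0 : ∑ j ∈ Finset.range (n + 1), (pfCoeff n 1 j : ℝ) * harmonicSum 1 N = 0 := by
      rw [← Finset.sum_mul]
      have := sum_pfCoeff_one n
      rw [show ∑ j ∈ Finset.range (n + 1), (pfCoeff n 1 j : ℝ) = 0 by exact_mod_cast this, zero_mul]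
    rw [← add_zero (∑ j ∈ Finset.range (n + 1), _), ← h0, ← Finset.sum_add_distrib]
    exact Finset.sum_congr rfl fun j _ => by ring
  · refine tendsto_finsetSum _ fun j _ => Tendsto.const_mul _ (Tendsto.sub_const ?_ _)
    rw [zetaSum, if_neg hs.ne']
    exact (tendsto_harmonicSum hs).comp (tendsto_add_atTop_nat j)

theorem rt_eq_sum (n : ℕ) : rt n = ∑ s ∈ Finset.Icc 1 6, ∑ j ∈ Finset.range (n + 1),
    (pfCoeff n s j : ℝ) * (zetaSum s - harmonicSum s j) := by
  refine tendsto_nhds_unique (hasSum_rt n).tendsto_sum_nat ?_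
  refine (tendsto_finsetSum (Finset.Icc 1 6) fun s hs =>
    tendsto_pfCoeff_sum n (Finset.mem_Icc.1 hs).1).congr fun N => ?_
  have e : ∀ k : ℕ, _ = _ := fun k =>
    term_eq_partialFractions n (show (0 : ℝ) < (k : ℝ) + 1 by positivity)
  simp_rw [e]
  symm
  rw [Finset.sum_comm]
  refine Finset.sum_congr rfl fun s _ => ?_
  rw [Finset.sum_comm]
  refine Finset.sum_congr rfl fun j _ => ?_
  rw [Finset.mul_sum]
  exact Finset.sum_congr rfl fun k _ => by ring

theorem rt_eq (n : ℕ) : rt n = ut n * zetaSum 5 + wt n * zetaSum 3 - vt n := by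
  have hv : (vt n : ℝ) = ∑ s ∈ Finset.Icc 1 6, ∑ j ∈ Finset.range (n + 1),
      (pfCoeff n s j : ℝ) * harmonicSum s j := by
    simp only [vt, harmonicSum]
    push_cast
    rfl
  have hz : ∀ s, ∑ j ∈ Finset.range (n + 1), (pfCoeff n s j : ℝ) * zetaSum s =
      ((∑ j ∈ Finset.range (n + 1), pfCoeff n s j : ℚ) : ℝ) * zetaSum s := fun s => by
    push_cast
    rw [Finset.sum_mul]
  rw [rt_eq_sum, hv]
  simp_rw [mul_sub, Finset.sum_sub_distrib, hz]
  congr 1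
  rw [Finset.sum_Icc_succ_top (by norm_num), Finset.sum_Icc_succ_top (by norm_num),
    Finset.sum_Icc_succ_top (by norm_num), Finset.sum_Icc_succ_top (by norm_num),
    Finset.sum_Icc_succ_top (by norm_num), Finset.Icc_self, Finset.sum_singleton,
    sum_pfCoeff_one, sum_pfCoeff_even (s := 1 + 1) (by norm_num) (by decide),
    sum_pfCoeff_even (s := 1 + 1 + 1 + 1) (by norm_num) (by decide),
    sum_pfCoeff_even (s := 1 + 1 + 1 + 1 + 1 + 1) (by norm_num) (by decide), ut, wt]
  push_cast
  ring

theorem rt_eq_riemannZeta (n : ℕ) : ((rt n : ℝ) : ℂ) =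
    (ut n : ℂ) * riemannZeta 5 + (wt n : ℂ) * riemannZeta 3 - (vt n : ℂ) := by
  have h5 := riemannZeta_eq_zetaSum (s := 5) (by norm_num)
  have h3 := riemannZeta_eq_zetaSum (s := 3) (by norm_num)
  push_cast at h5 h3
  rw [h5, h3, rt_eq]
  push_cast
  rfl

end LinearForm

/-! ### Linearity of the recursion and the rational part. -/

section LinearRecursion

theorem SatisfiesRecursion.map {K L : Type*} [CommRing K] [CommRing L] (f : K →+* L) {x : ℕ → K}
    (h : SatisfiesRecursion x) : SatisfiesRecursion fun n => f (x n) := by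
  intro n hn
  have := congrArg f (h n hn)
  simpa only [map_add, map_sub, map_mul, map_pow, map_natCast, map_ofNat, map_one, map_b0, map_b1,
    map_b2, map_zero] using this

theorem SatisfiesRecursion.of_map {K L : Type*} [CommRing K] [CommRing L] (f : K →+* L)
    (hf : Function.Injective f) {x : ℕ → K} (h : SatisfiesRecursion fun n => f (x n)) :
    SatisfiesRecursion x := by
  intro n hn
  apply hf
  have := h n hn
  simpa only [map_add, map_sub, map_mul, map_pow, map_natCast, map_ofNat, map_one, map_b0, map_b1,
    map_b2, map_zero] using this

theorem SatisfiesRecursion.add {K : Type*} [CommRing K] {x y : ℕ → K} (hx : SatisfiesRecursion x)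
    (hy : SatisfiesRecursion y) : SatisfiesRecursion fun n => x n + y n := fun n hn => by
  linear_combination hx n hn + hy n hn

theorem SatisfiesRecursion.mul_const {K : Type*} [CommRing K] {x : ℕ → K}
    (hx : SatisfiesRecursion x) (c : K) : SatisfiesRecursion fun n => x n * c := fun n hn => by
  linear_combination c * hx n hn

theorem ut_satisfiesRecursion : SatisfiesRecursion ut :=
  sum_pfCoeff_satisfiesRecursion (by norm_num)

theorem wt_satisfiesRecursion : SatisfiesRecursion wt :=
  sum_pfCoeff_satisfiesRecursion (by norm_num)

/-- The part of the linear form without the rational term. -/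
noncomputable def zetaForm (n : ℕ) : ℝ := ut n * zetaSum 5 + wt n * zetaSum 3

theorem zetaForm_satisfiesRecursion : SatisfiesRecursion zetaForm :=
  ((ut_satisfiesRecursion.map (Rat.castHom ℝ)).mul_const _).add
    ((wt_satisfiesRecursion.map (Rat.castHom ℝ)).mul_const _)

theorem vt_eq (n : ℕ) : (vt n : ℝ) = zetaForm n + rt n * (-1) := by
  rw [rt_eq, zetaForm]
  ring

/-- Over ℝ, `vt` is a linear combination of three solutions; injectivity of ℚ → ℝ brings the
recursion back to ℚ. -/
theorem vt_satisfiesRecursion : SatisfiesRecursion vt := by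
  refine SatisfiesRecursion.of_map (Rat.castHom ℝ) (Rat.castHom ℝ).injective ?_
  have e : (fun n => Rat.castHom ℝ (vt n)) = fun n => zetaForm n + rt n * (-1) := funext vt_eq
  rw [e]
  exact zetaForm_satisfiesRecursion.add (rt_satisfiesRecursion.mul_const (-1))

end LinearRecursion

/-! ### Values of ũ and w̃ at n = 0, 1, 2. -/

section InitialValues

open Polynomial

/-- A polynomial certificate for the Taylor coefficients of orders 1 = 6 - 5 and 3 = 6 - 3: p is the
remainder of the division truncated at order four. -/
theorem pfCoeff_of_numerator_eq {n j : ℕ} {a₀ a₁ a₂ a₃ : ℚ} {p : ℚ[X]} (h : numerator n = (C a₀ + C a₁ * (X + C (j : ℚ)) + C a₂ * (X + C (j : ℚ)) ^ 2 +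
      C a₃ * (X + C (j : ℚ)) ^ 3) * codenominator n j + (X + C (j : ℚ)) ^ 4 * p) :
    pfCoeff n 5 j = a₁ ∧ pfCoeff n 3 j = a₃ := by
  set D := expandAt j (codenominator n j) with hD
  have hD0 : PowerSeries.constantCoeff D ≠ 0 := by
    simp only [hD, codenominator, map_prod, map_pow, expandAt_X_add_C]
    simp only [map_add, PowerSeries.constantCoeff_X, PowerSeries.constantCoeff_C, zero_add]
    refine Finset.prod_ne_zero_iff.2 fun i hi => pow_ne_zero _ ?_
    rw [sub_ne_zero]
    exact_mod_cast (Finset.mem_erase.1 hi).1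
  have hX : expandAt j (X + C (j : ℚ)) = PowerSeries.X := by
    rw [expandAt_X_add_C, sub_self, map_zero, add_zero]
  have h' := congrArg (expandAt j) h
  rw [expandAt_numerator, ← hD] at h'
  simp only [map_add, map_mul, map_pow, ← hD] at h'
  rw [← map_add, hX] at h'
  simp only [expandAt_C] at h'
  have hloc : localExpansion n j = PowerSeries.C a₀ + PowerSeries.C a₁ * PowerSeries.X +
      PowerSeries.C a₂ * PowerSeries.X ^ 2 + PowerSeries.C a₃ * PowerSeries.X ^ 3 +
      PowerSeries.X ^ 4 * (expandAt j p * D⁻¹) := by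
    have hi := PowerSeries.mul_inv_cancel D hD0
    linear_combination D⁻¹ * h' - (localExpansion n j - (PowerSeries.C a₀ +
      PowerSeries.C a₁ * PowerSeries.X + PowerSeries.C a₂ * PowerSeries.X ^ 2 +
      PowerSeries.C a₃ * PowerSeries.X ^ 3)) * hi
  constructor
  · rw [pfCoeff, hloc]
    simp [PowerSeries.coeff_X_pow, PowerSeries.coeff_X_pow_mul', PowerSeries.coeff_C]
  · rw [pfCoeff, hloc]
    simp [PowerSeries.coeff_X_pow, PowerSeries.coeff_X_pow_mul']

theorem pfCoeff_1_0 : pfCoeff 1 5 0 = 1 ∧ pfCoeff 1 3 0 = 6 :=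
  pfCoeff_of_numerator_eq (a₀ := 0) (a₂ := -7/2)
    (p := C (-6) + C (-36) * X + C (-147/2) * X ^ 2 + C (-70) * X ^ 3 + C (-65/2) * X ^ 4 + C (-6) *
      X ^ 5)
    (Polynomial.funext fun r => by
      have e : (Finset.range (1 + 1)).erase 0 = {1} := by decide
      simp [numerator, codenominator, e, Finset.prod_range_succ, Nat.factorial]
      ring)

theorem pfCoeff_2_0 : pfCoeff 2 5 0 = -12 ∧ pfCoeff 2 3 0 = -454 :=
  pfCoeff_of_numerator_eq (a₀ := 0) (a₂ := 101)
    (p := C (93632) + C (598976) * X + C (1793540) * X ^ 2 + C (3290096) * X ^ 3 + C (4076671) * X ^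
      4 + C (3562048) * X ^ 5 + C (2230557) * X ^ 6 + C (998214) * X ^ 7 + C (312249) * X ^ 8 +
      C (64932) * X ^ 9 + C (8071) * X ^ 10 + C (454) * X ^ 11)
    (Polynomial.funext fun r => by
      have e : (Finset.range (2 + 1)).erase 0 = {1, 2} := by decide
      simp [numerator, codenominator, e, Finset.prod_range_succ, Nat.factorial]
      ring)

/-- The point -1 is the centre of the symmetry for n = 2, so only odd powers of t + 1 occur. -/
theorem pfCoeff_2_1 : pfCoeff 2 5 1 = 576 ∧ pfCoeff 2 3 1 = 2672 :=
  pfCoeff_of_numerator_eq (a₀ := 0) (a₂ := 0)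
    (p := C (7616) * (X + C 1) + C (-28576) * (X + C 1) ^ 3 + C (44800) * (X + C 1) ^ 5 + C (-36624)
      * (X + C 1) ^ 7 + C (15456) * (X + C 1) ^ 9 + C (-2672) * (X + C 1) ^ 11)
    (Polynomial.funext fun r => by
      have e : (Finset.range (2 + 1)).erase 1 = {0, 2} := by decide
      simp [numerator, codenominator, e, Finset.prod_range_succ, Nat.factorial]
      ring)

theorem pfCoeff_zero : pfCoeff 0 5 0 = 0 ∧ pfCoeff 0 3 0 = -1 :=
  pfCoeff_of_numerator_eq (a₀ := 0) (a₂ := 0) (p := 0)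
    (Polynomial.funext fun r => by
      simp [numerator, codenominator, Nat.factorial]
      ring)

theorem ut_zero : ut 0 = 0 := by simp [ut, pfCoeff_zero.1]

theorem wt_zero : wt 0 = -1 := by simp [wt, pfCoeff_zero.2]

theorem pfCoeff_reflect_odd {n j s : ℕ} (hs : s ≤ 6) (ho : Odd s)
    (hj : j ∈ Finset.range (n + 1)) : pfCoeff n s (n - j) = pfCoeff n s j := by
  have := pfCoeff_reflect hs hj
  rw [ho.neg_one_pow] at this
  linarith

theorem ut_one : ut 1 = 2 := by
  have := pfCoeff_reflect_odd (n := 1) (j := 0) (s := 5) (by norm_num) (by decide)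
  simp only [Nat.sub_zero] at this
  simp [ut, Finset.sum_range_succ, this, pfCoeff_1_0.1]
  norm_num

theorem wt_one : wt 1 = 12 := by
  have := pfCoeff_reflect_odd (n := 1) (j := 0) (s := 3) (by norm_num) (by decide)
  simp only [Nat.sub_zero] at this
  simp [wt, Finset.sum_range_succ, this, pfCoeff_1_0.2]
  norm_num

theorem ut_two : ut 2 = 552 := by
  have := pfCoeff_reflect_odd (n := 2) (j := 0) (s := 5) (by norm_num) (by decide)
  simp only [Nat.sub_zero] at this
  simp [ut, Finset.sum_range_succ, this, pfCoeff_2_0.1, pfCoeff_2_1.1]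
  norm_num

theorem wt_two : wt 2 = 1764 := by
  have := pfCoeff_reflect_odd (n := 2) (j := 0) (s := 3) (by norm_num) (by decide)
  simp only [Nat.sub_zero] at this
  simp [wt, Finset.sum_range_succ, this, pfCoeff_2_0.2, pfCoeff_2_1.2]
  norm_num

end InitialValues

/-! ### Bounds and limits of the coefficients of the recursion. -/

section RecursionCoefficients

/-- The coefficient of `x (m + 3)` in the recursion shifted to start at `0`. -/
def recDen (x : ℝ) : ℝ := (x + 2) ^ 3 * (x + 3) ^ 3 * b0 (x + 1)

/-- The coefficient of `x (m + 2)`, up to sign in the recursion shifted to start at `0`. -/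
def recA (x : ℝ) : ℝ := 2 * (x + 2) * b1 (x + 2)

/-- The coefficient of `x (m + 1)`, up to sign in the recursion shifted to start at `0`. -/
def recB (x : ℝ) : ℝ := b2 (x + 2)

/-- The coefficient of `x m` in the recursion shifted to start at `0`. -/
def recC (x : ℝ) : ℝ := 2 * (x + 2) * (x + 1) ^ 4 * (2 * x + 1) * b0 (x + 2)

theorem recDen_eq (x : ℝ) : recDen x = ∑ i ∈ Finset.range 14,
    [12864528, 125514144, 546824664, 1410940264, 2412208689, 2893163272, 2509975492, 1597537210,
    746956177, 253657258, 60857182, 9774418, 942444, 41218].getD i 0 * x ^ i := by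
  simp only [Finset.sum_range_succ, Finset.sum_range_zero, List.getD_cons_zero,
    List.getD_cons_succ, recDen, b0]
  ring

theorem recA_eq (x : ℝ) : recA x = ∑ i ∈ Finset.range 14,
    [2363925696, 22848605160, 98623314384, 252268588698, 428061384414, 510435668838,
    441215573402, 280516212002, 131403260422, 44854256122, 10857189118, 1766488420, 173304980,
    7748984].getD i 0 * x ^ i := by
  simp only [Finset.sum_range_succ, Finset.sum_range_zero, List.getD_cons_zero,
    List.getD_cons_succ, recA, b1]
  ring

theorem recB_eq (x : ℝ) : recB x = ∑ i ∈ Finset.range 14,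
    [23947661088, 234573261144, 1026849900564, 2665119720756, 4589869100382, 5555924854192,
    4876376028832, 3149325487304, 1499533071270, 520741866924, 128375070264, 21299986208,
    2134103168, 97604224].getD i 0 * x ^ i := by
  simp only [Finset.sum_range_succ, Finset.sum_range_zero, List.getD_cons_zero,
    List.getD_cons_succ, recB, b2]
  ring

theorem recC_eq (x : ℝ) : recC x = ∑ i ∈ Finset.range 14,
    [29123280, 288325740, 1282086246, 3399458322, 6008510544, 7487368708, 6776375142,
    4515092810, 2217156888, 793277820, 201203352, 34289648, 3522468, 164872].getD i 0 * x ^ i :=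
    by
  simp only [Finset.sum_range_succ, Finset.sum_range_zero, List.getD_cons_zero,
    List.getD_cons_succ, recC, b0]
  ring

theorem recDen_pos {x : ℝ} (hx : 0 ≤ x) : 0 < recDen x := by
  rw [recDen_eq]
  simp only [Finset.sum_range_succ, Finset.sum_range_zero, List.getD_cons_zero,
    List.getD_cons_succ]
  positivity

/-- In the variable x = n - 2 the difference of the two sides has only positive coefficients; the
same holds for the next two bounds. -/
theorem le_recA {x : ℝ} (hx : 0 ≤ x) : 100 * recDen x ≤ recA x := by
  have h : recA x - 100 * recDen x =
      1077472896 + 10297190760 * x + 43940847984 * x ^ 2 + 111174562298 * x ^ 3 + 186840515514 *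
      x ^ 4 + 221119341638 * x ^ 5 + 190218024202 * x ^ 6 + 120762491002 * x ^ 7 + 56707642722 *
      x ^ 8 + 19488530322 * x ^ 9 + 4771470918 * x ^ 10 + 789046620 * x ^ 11 + 79060580 * x ^ 12
      + 3627184 * x ^ 13 := by
    simp only [recA, recDen, b0, b1]
    ring
  have : 0 ≤ recA x - 100 * recDen x := by rw [h]; positivity
  linarith

theorem le_recB {x : ℝ} (hx : 0 ≤ x) : 1000 * recDen x ≤ recB x := by
  have h : recB x - 1000 * recDen x =
      11083133088 + 109059117144 * x + 480025236564 * x ^ 2 + 1254179456756 * x ^ 3 +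
      2177660411382 * x ^ 4 + 2662761582192 * x ^ 5 + 2366400536832 * x ^ 6 + 1551788277304 * x
      ^ 7 + 752576894270 * x ^ 8 + 267084608924 * x ^ 9 + 67517888264 * x ^ 10 + 11525568208 * x
      ^ 11 + 1191659168 * x ^ 12 + 56386224 * x ^ 13 := by
    simp only [recB, recDen, b0, b2]
    ring
  have : 0 ≤ recB x - 1000 * recDen x := by rw [h]; positivity
  linarith

theorem recC_le {x : ℝ} (hx : 0 ≤ x) : recC x ≤ 4 * recDen x := by
  have h : 4 * recDen x - recC x =
      22334832 + 213730836 * x + 905212410 * x ^ 2 + 2244302734 * x ^ 3 + 3640324212 * x ^ 4 +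
      4085284380 * x ^ 5 + 3263526826 * x ^ 6 + 1875056030 * x ^ 7 + 770667820 * x ^ 8 +
      221351212 * x ^ 9 + 42225376 * x ^ 10 + 4808024 * x ^ 11 + 247308 * x ^ 12 := by
    simp only [recC, recDen, b0]
    ring
  have : 0 ≤ 4 * recDen x - recC x := by rw [h]; positivity
  linarith

theorem recC_nonneg {x : ℝ} (hx : 0 ≤ x) : 0 ≤ recC x := by
  rw [recC_eq]
  simp only [Finset.sum_range_succ, Finset.sum_range_zero, List.getD_cons_zero,
    List.getD_cons_succ]
  positivity

theorem tendsto_sum_mul_pow_div (a : ℕ → ℝ) (d : ℕ) :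
    Tendsto (fun x : ℝ => (∑ i ∈ Finset.range (d + 1), a i * x ^ i) / x ^ d) atTop (𝓝 (a d)) := by
  have h : ∀ i ∈ Finset.range d, Tendsto (fun x : ℝ => a i * x⁻¹ ^ (d - i)) atTop (𝓝 0) := by
    intro i hi
    have := Finset.mem_range.1 hi
    simpa [zero_pow (by omega : d - i ≠ 0)] using
      (tendsto_inv_atTop_zero.pow (d - i)).const_mul (a i)
  have h' := (tendsto_finsetSum _ h).add_const (a d)
  rw [Finset.sum_const_zero, zero_add] at h'
  refine h'.congr' ?_
  filter_upwards [eventually_gt_atTop 0] with x hx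
  rw [Finset.sum_range_succ, add_div, mul_div_cancel_right₀ _ (pow_pos hx d).ne', Finset.sum_div]
  congr 1
  refine Finset.sum_congr rfl fun i hi => ?_
  have : x ^ d = x ^ (d - i) * x ^ i := by
    rw [← pow_add, Nat.sub_add_cancel (Finset.mem_range.1 hi).le]
  rw [this, inv_pow]
  field_simp

theorem tendsto_sum_div_sum (a b : ℕ → ℝ) (d : ℕ) (hb : b d ≠ 0) :
    Tendsto (fun x : ℝ => (∑ i ∈ Finset.range (d + 1), a i * x ^ i) /
      ∑ i ∈ Finset.range (d + 1), b i * x ^ i) atTop (𝓝 (a d / b d)) := by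
  refine ((tendsto_sum_mul_pow_div a d).div (tendsto_sum_mul_pow_div b d) hb).congr' ?_
  filter_upwards [eventually_gt_atTop 0] with x hx
  exact div_div_div_cancel_right₀ (pow_pos hx d).ne' _ _

theorem tendsto_recA_div : Tendsto (fun n : ℕ => recA n / recDen n) atTop (𝓝 188) := by
  have h : Tendsto (fun x : ℝ => recA x / recDen x) atTop (𝓝 188) := by
    simp only [recA_eq, recDen_eq]
    convert tendsto_sum_div_sum _ _ 13 _ using 2
    · norm_num
    · norm_num
  exact h.comp tendsto_natCast_atTop_atTop

theorem tendsto_recB_div : Tendsto (fun n : ℕ => recB n / recDen n) atTop (𝓝 2368) := by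
  have h : Tendsto (fun x : ℝ => recB x / recDen x) atTop (𝓝 2368) := by
    simp only [recB_eq, recDen_eq]
    convert tendsto_sum_div_sum _ _ 13 _ using 2
    · norm_num
    · norm_num
  exact h.comp tendsto_natCast_atTop_atTop

theorem tendsto_recC_div : Tendsto (fun n : ℕ => recC n / recDen n) atTop (𝓝 4) := by
  have h : Tendsto (fun x : ℝ => recC x / recDen x) atTop (𝓝 4) := by
    simp only [recC_eq, recDen_eq]
    convert tendsto_sum_div_sum _ _ 13 _ using 2
    · norm_num
    · norm_num
  exact h.comp tendsto_natCast_atTop_atTop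

theorem SatisfiesRecursion.shift {x : ℕ → ℝ} (h : SatisfiesRecursion x) (m : ℕ) :
    recDen m * x (m + 3) = recA m * x (m + 2) + recB m * x (m + 1) - recC m * x m := by
  have := h (m + 2) (by omega)
  have e1 : (m : ℝ) + 2 - 1 = m + 1 := by ring
  have e2 : (m : ℝ) + 2 + 1 = m + 3 := by ring
  have e3 : 2 * ((m : ℝ) + 2) - 3 = 2 * m + 1 := by ring
  push_cast at this
  rw [e1, e2, e3] at this
  change _ * x (m + 3) - _ * x (m + 2) - _ * x (m + 1) + _ * x m = 0 at this
  rw [recDen, recA, recB, recC]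
  linarith

theorem SatisfiesRecursion.eq_div {x : ℕ → ℝ} (h : SatisfiesRecursion x) (m : ℕ) :
    x (m + 3) = recA m / recDen m * x (m + 2) + recB m / recDen m * x (m + 1)
      - recC m / recDen m * x m := by
  have hd := recDen_pos m.cast_nonneg
  have := h.shift m
  field_simp
  linarith

end RecursionCoefficients

/-! ### Logarithmic rates from ratios, the contraction lemma and geometric growth. -/

section Growth

theorem hasLogRate_of_tendsto_sub {x : ℕ → ℝ} {a : ℝ}
    (h : Tendsto (fun n => Real.log |x (n + 1)| - Real.log |x n|) atTop (𝓝 a)) :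
    HasLogRate x a := by
  have h1 := h.cesaro
  simp_rw [Finset.sum_range_sub (fun n => Real.log |x n|)] at h1
  have h2 : Tendsto (fun n : ℕ => (n : ℝ)⁻¹ * Real.log |x 0|) atTop (𝓝 0) := by
    simpa using tendsto_inv_atTop_nhds_zero_nat.mul_const (Real.log |x 0|)
  have h3 := h1.add h2
  rw [add_zero] at h3
  exact h3.congr fun n => by ring

theorem hasLogRate_of_tendsto_ratio {x : ℕ → ℝ} {a : ℝ} (ha : a ≠ 0) (hx : ∀ᶠ n in atTop, x n ≠ 0)
    (h : Tendsto (fun n => x (n + 1) / x n) atTop (𝓝 a)) : HasLogRate x (Real.log a) := by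
  refine hasLogRate_of_tendsto_sub ((h.log ha).congr' ?_)
  filter_upwards [hx, (tendsto_add_atTop_nat 1).eventually hx] with n h1 h2
  rw [Real.log_div h2 h1, Real.log_abs, Real.log_abs]

/-- In substance limsup e ≤ (limsup e)/2. Taking η = M/4 improves an eventual bound M to 3M/4, and
this is iterated. -/
theorem tendsto_zero_of_eventually_le_half {e : ℕ → ℝ} (h0 : ∀ n, 0 ≤ e n) {M : ℝ} (hM : 0 < M)
    (hb : ∀ᶠ n in atTop, e n ≤ M)
    (hs : ∀ M, (∀ᶠ n in atTop, e n ≤ M) → ∀ η > 0, ∀ᶠ n in atTop, e n ≤ M / 2 + η) :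
    Tendsto e atTop (𝓝 0) := by
  have hk : ∀ k : ℕ, ∀ᶠ n in atTop, e n ≤ M * (3 / 4) ^ k := by
    intro k
    induction k with
    | zero => simpa using hb
    | succ k ih =>
      filter_upwards [hs _ ih (M * (3 / 4) ^ k / 4) (by positivity)] with n hn
      calc e n ≤ _ := hn
        _ = _ := by ring
  have hl : Tendsto (fun k : ℕ => M * (3 / 4 : ℝ) ^ k) atTop (𝓝 0) := by
    simpa using (tendsto_pow_atTop_nhds_zero_of_lt_one (by norm_num : (0 : ℝ) ≤ 3 / 4)
      (by norm_num)).const_mul M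
  rw [Metric.tendsto_atTop']
  intro ε hε
  obtain ⟨k, hk'⟩ := (hl.eventually (gt_mem_nhds hε)).exists
  obtain ⟨N, hN⟩ := eventually_atTop.1 (hk k)
  refine ⟨N, fun n hn => ?_⟩
  rw [Real.dist_eq, sub_zero, abs_of_nonneg (h0 n)]
  exact (hN n hn.le).trans_lt hk'

/-- Convergence of a bounded sequence determined by a slowly varying contraction. -/
theorem tendsto_of_contraction {s P Q R N : ℕ → ℝ} {u v : ℕ → ℕ} {σ p q r c : ℝ}
    (hu : Tendsto u atTop atTop) (hv : Tendsto v atTop atTop)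
    (hP : Tendsto P atTop (𝓝 p)) (hQ : Tendsto Q atTop (𝓝 q)) (hR : Tendsto R atTop (𝓝 r))
    (hN : Tendsto N atTop (𝓝 c))
    (hs : ∀ᶠ n in atTop, 0 ≤ s n ∧ s n ≤ 1 / 100) (hσ : 0 ≤ σ ∧ σ ≤ 1 / 100)
    (hp : 150 < p) (hq : 0 ≤ q ∧ q ≤ 2400) (hr : 0 ≤ r ∧ r ≤ 4)
    (hrec : ∀ᶠ n in atTop, s n * (P n + Q n * s (u n) - R n * (s (u n) * s (v n))) = N n)
    (hfix : σ * (p + q * σ - r * (σ * σ)) = c) : Tendsto s atTop (𝓝 σ) := by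
  rw [tendsto_iff_norm_sub_tendsto_zero]
  have hsu := hu.eventually hs
  have hsv := hv.eventually hs
  refine tendsto_zero_of_eventually_le_half (fun n => norm_nonneg _) one_pos ?_ ?_
  · filter_upwards [hs] with n hn
    rw [Real.norm_eq_abs, abs_le]
    constructor <;> linarith [hn.1, hn.2, hσ.1, hσ.2]
  intro M hM η hη
  have dP : Tendsto (fun n => |P n - p|) atTop (𝓝 0) := by
    simpa using (hP.sub_const p).abs
  have dQ : Tendsto (fun n => |Q n - q|) atTop (𝓝 0) := by
    simpa using (hQ.sub_const q).abs
  have dR : Tendsto (fun n => |R n - r|) atTop (𝓝 0) := by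
    simpa using (hR.sub_const r).abs
  have dN : Tendsto (fun n => |N n - c|) atTop (𝓝 0) := by
    simpa using (hN.sub_const c).abs
  have hη' : 0 < min η 1 := lt_min hη one_pos
  filter_upwards [hs, hsu, hsv, hu.eventually hM, hv.eventually hM, hrec,
    dP.eventually (gt_mem_nhds hη'), dQ.eventually (gt_mem_nhds hη'),
    dR.eventually (gt_mem_nhds hη'), dN.eventually (gt_mem_nhds hη')]
    with n h0 ha hb ma mb he eP eQ eR eN
  rw [Real.norm_eq_abs] at ma mb ⊢
  generalize s (u n) = a at *
  generalize s (v n) = b at *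
  generalize s n = x at *
  generalize P n = P' at *
  generalize Q n = Q' at *
  generalize R n = R' at *
  generalize N n = N' at *
  clear hs hsu hsv hM hrec dP dQ dR dN hP hQ hR hN hu hv
  have m1 := min_le_left η 1
  have m2 := min_le_right η 1
  set η' := min η 1
  obtain ⟨x0, x1⟩ := h0
  obtain ⟨a0, a1⟩ := ha
  obtain ⟨b0, b1⟩ := hb
  obtain ⟨s0, s1⟩ := hσ
  have M0 : 0 ≤ M := (abs_nonneg _).trans ma
  have ab0 : 0 ≤ a * b := mul_nonneg a0 b0
  have ab1 : a * b ≤ 1 / 10000 := by nlinarith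
  -- P' > 149 once it is within 1 of p > 150, and the other two terms are tiny because a, b ≤ 1/100.
  have hD : 100 ≤ P' + Q' * a - R' * (a * b) := by
    have h1 := (abs_lt.1 eP).1
    have h2 := (abs_lt.1 eQ).1
    have h3 := (abs_lt.1 eR).2
    have : -1 / 100 ≤ Q' * a := by nlinarith [hq.1]
    have : R' * (a * b) ≤ 5 / 10000 := by nlinarith [hr.2]
    linarith
  -- Subtracting the fixed-point equation leaves coefficient errors plus errors of earlier or later
  -- terms. The latter have total weight at most σ(q + 4/50) ≤ 2401/100, against a factor of at
  -- least 100 on the left.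
  have key : (x - σ) * (P' + Q' * a - R' * (a * b)) = (N' - c) - σ * ((P' - p) + (Q' - q) * a
      - (R' - r) * (a * b) + q * (a - σ) - r * (a * (b - σ) + σ * (a - σ))) := by
    rw [← hfix, ← he]
    ring
  have bound : |(x - σ) * (P' + Q' * a - R' * (a * b))| ≤ 2 * η' + 1 / 100 * (2401 * M) := by
    rw [key]
    have t1 : |(Q' - q) * a| ≤ η' * (1 / 100) := by
      rw [abs_mul, abs_of_nonneg a0]
      exact mul_le_mul eQ.le a1 a0 hη'.le
    have t2 : |(R' - r) * (a * b)| ≤ η' * (1 / 10000) := by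
      rw [abs_mul, abs_of_nonneg ab0]
      exact mul_le_mul eR.le ab1 ab0 hη'.le
    have t3 : |q * (a - σ)| ≤ 2400 * M := by
      rw [abs_mul, abs_of_nonneg hq.1]
      exact mul_le_mul hq.2 ma (abs_nonneg _) (by norm_num)
    have t4 : |a * (b - σ)| ≤ 1 / 100 * M := by
      rw [abs_mul, abs_of_nonneg a0]
      exact mul_le_mul a1 mb (abs_nonneg _) (by norm_num)
    have t5 : |σ * (a - σ)| ≤ 1 / 100 * M := by
      rw [abs_mul, abs_of_nonneg s0]
      exact mul_le_mul s1 ma (abs_nonneg _) (by norm_num)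
    have t6 : |r * (a * (b - σ) + σ * (a - σ))| ≤ 4 * (1 / 50 * M) := by
      rw [abs_mul, abs_of_nonneg hr.1]
      refine mul_le_mul hr.2 ?_ (abs_nonneg _) (by norm_num)
      refine (abs_add_le _ _).trans ?_
      linarith
    have t7 : |(P' - p) + (Q' - q) * a - (R' - r) * (a * b) + q * (a - σ)
        - r * (a * (b - σ) + σ * (a - σ))| ≤ 2 * η' + 2401 * M := by
      rw [abs_le] at t1 t2 t3 t6 ⊢
      have := abs_lt.1 eP
      constructor <;> linarith [t1.1, t1.2, t2.1, t2.2, t3.1, t3.2, t6.1, t6.2, this.1, this.2]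
    have t8 : |σ * ((P' - p) + (Q' - q) * a - (R' - r) * (a * b) + q * (a - σ)
        - r * (a * (b - σ) + σ * (a - σ)))| ≤ 1 / 100 * (2 * η' + 2401 * M) := by
      rw [abs_mul, abs_of_nonneg s0]
      exact mul_le_mul s1 t7 (abs_nonneg _) (by norm_num)
    refine (abs_sub _ _).trans ?_
    linarith
  rw [abs_mul, abs_of_nonneg (by linarith : 0 ≤ P' + Q' * a - R' * (a * b))] at bound
  have : |x - σ| * 100 ≤ 2 * η' + 1 / 100 * (2401 * M) :=
    (mul_le_mul_of_nonneg_left hD (abs_nonneg _)).trans bound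
  linarith

theorem recCoeff_bounds (m : ℕ) : 100 ≤ recA m / recDen m ∧ 1000 ≤ recB m / recDen m ∧
    0 ≤ recC m / recDen m ∧ recC m / recDen m ≤ 4 := by
  have hm : (0 : ℝ) ≤ m := m.cast_nonneg
  have hd := recDen_pos hm
  refine ⟨?_, ?_, div_nonneg (recC_nonneg hm) hd.le, ?_⟩
  · rw [le_div_iff₀ hd]; exact le_recA hm
  · rw [le_div_iff₀ hd]; exact le_recB hm
  · rw [div_le_iff₀ hd]; exact recC_le hm

/-- A solution of the recursion with suitable initial values grows geometrically. -/
theorem SatisfiesRecursion.growth {x : ℕ → ℝ} (h : SatisfiesRecursion x) (h0 : x 0 ≤ 0)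
    (h1 : 0 < x 1) (h2 : 100 * x 1 ≤ x 2) : ∀ n, 0 < x (n + 1) ∧ 100 * x (n + 1) ≤ x (n + 2) := by
  have key : ∀ m, 0 < x (m + 1) → 100 * x (m + 1) ≤ x (m + 2) → x m ≤ x (m + 1) →
      0 < x (m + 2) ∧ 100 * x (m + 2) ≤ x (m + 3) := by
    intro m hm1 hm2 hm0
    obtain ⟨hA, hB, hC, hC'⟩ := recCoeff_bounds m
    have hp : 0 < x (m + 2) := by linarith
    refine ⟨hp, ?_⟩
    rw [h.eq_div m]
    have e1 : 100 * x (m + 2) ≤ recA m / recDen m * x (m + 2) := by gcongr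
    have e2 : 1000 * x (m + 1) ≤ recB m / recDen m * x (m + 1) := by gcongr
    have e3 : recC m / recDen m * x m ≤ recC m / recDen m * x (m + 1) := by gcongr
    have e4 : recC m / recDen m * x (m + 1) ≤ 4 * x (m + 1) := by gcongr
    linarith
  -- Monotonicity is carried along so that the negative term C x_m, at most 4x_{m+1}, is absorbed by
  -- B x_{m+1}; x 0 itself may be negative.
  have main : ∀ n, (0 < x (n + 1) ∧ 100 * x (n + 1) ≤ x (n + 2)) ∧ x n ≤ x (n + 1) := by
    intro n
    induction n with
    | zero => exact ⟨⟨h1, h2⟩, by linarith⟩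
    | succ n ih => exact ⟨key n ih.1.1 ih.1.2 ih.2, by linarith [ih.1.1, ih.1.2]⟩
  exact fun n => (main n).1

end Growth

/-! ### Exact rates of the growing and the decaying solutions. -/

section Rates

/-- Dividing the recursion by its newest term, s_n = x_n/x_{n+1} satisfies s_n(A + B s_{n-1} - C
s_{n-1}s_{n-2}) = 1, whose limiting fixed point is 1/l. -/
theorem SatisfiesRecursion.hasLogRate_of_growth {x : ℕ → ℝ} (h : SatisfiesRecursion x)
    (hg : ∀ n, 0 < x (n + 1) ∧ 100 * x (n + 1) ≤ x (n + 2)) {l : ℝ} (hl : 100 ≤ l)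
    (hroot : l ^ 3 - 188 * l ^ 2 - 2368 * l + 4 = 0) : HasLogRate x (Real.log l) := by
  have hpos : ∀ n, 1 ≤ n → 0 < x n := fun n hn => by
    obtain ⟨k, rfl⟩ := Nat.exists_eq_add_of_le' hn
    exact (hg k).1
  have hl0 : l ≠ 0 := by positivity
  have hs : Tendsto (fun n => x n / x (n + 1)) atTop (𝓝 l⁻¹) := by
    have t2 : Tendsto (fun n : ℕ => n - 2) atTop atTop := tendsto_sub_atTop_nat 2
    refine tendsto_of_contraction (u := fun n => n - 1) (v := fun n => n - 2)
      (tendsto_sub_atTop_nat 1) t2 (tendsto_recA_div.comp t2) (tendsto_recB_div.comp t2)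
      (tendsto_recC_div.comp t2) (tendsto_const_nhds (x := (1 : ℝ))) ?_ ⟨by positivity, ?_⟩
      (by norm_num) (by norm_num) (by norm_num) ?_ ?_
    · filter_upwards [eventually_ge_atTop 1] with n hn
      obtain ⟨k, rfl⟩ := Nat.exists_eq_add_of_le' hn
      obtain ⟨h1, h2⟩ := hg k
      have h3 : 0 < x (k + 1 + 1) := (hg (k + 1)).1
      refine ⟨by positivity, ?_⟩
      rw [div_le_iff₀ h3]
      change x (k + 1) ≤ 1 / 100 * x (k + 2)
      linarith
    · rw [inv_eq_one_div]
      exact one_div_le_one_div_of_le (by norm_num) hl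
    -- Starting at 3 keeps x 0, which need not be positive, out of the denominators.
    · filter_upwards [eventually_ge_atTop 3] with n hn
      obtain ⟨m, rfl⟩ := Nat.exists_eq_add_of_le' (by omega : 2 ≤ n)
      have e := h.eq_div m
      have p0 := hpos m (by omega)
      have p1 := hpos (m + 1) (by omega)
      have p2 := hpos (m + 2) (by omega)
      have p3 := hpos (m + 3) (by omega)
      simp only [Function.comp, show m + 2 - 1 = m + 1 by omega, show m + 2 - 2 = m by omega,
        show m + 1 + 1 = m + 2 by omega, show m + 2 + 1 = m + 3 by omega]
      generalize recA m / recDen m = A at *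
      generalize recB m / recDen m = B at *
      generalize recC m / recDen m = C at *
      field_simp
      linarith
    · field_simp
      linarith
  refine hasLogRate_of_tendsto_ratio hl0 ?_ ?_
  · filter_upwards [eventually_ge_atTop 1] with n hn using (hpos n hn).ne'
  · simpa using hs.inv₀ (inv_ne_zero hl0)

/-- A bounded positive solution of the recursion decays geometrically. -/
theorem SatisfiesRecursion.decay {y : ℕ → ℝ} (h : SatisfiesRecursion y) (hpos : ∀ n, 0 < y n)
    {K : ℝ} (hK : ∀ n, y n ≤ K) (m : ℕ) : y (m + 1) ≤ 1 / 100 * y m := by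
  by_contra! hm
  -- If y_m < 100 y_{m+1}, then y_{m+3} ≥ 100 y_{m+2} + 1000 y_{m+1} - 4y_m exceeds 100 y_{m+2} +
  -- 600 y_{m+1}. The failure of decay thus propagates by two indices and doubles the value,
  -- contradicting boundedness.
  have step : ∀ m, 1 / 100 * y m < y (m + 1) →
      1 / 100 * y (m + 2) < y (m + 3) ∧ 2 * y (m + 1) ≤ y (m + 3) := by
    intro m hm
    obtain ⟨hA, hB, hC, hC'⟩ := recCoeff_bounds m
    have p0 := hpos m
    have p1 := hpos (m + 1)
    have p2 := hpos (m + 2)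
    rw [h.eq_div m]
    have e1 : 100 * y (m + 2) ≤ recA m / recDen m * y (m + 2) := by gcongr
    have e2 : 1000 * y (m + 1) ≤ recB m / recDen m * y (m + 1) := by gcongr
    have e3 : recC m / recDen m * y m ≤ 4 * y m := by gcongr
    constructor <;> linarith
  have grow : ∀ k, 1 / 100 * y (m + 2 * k) < y (m + 2 * k + 1) ∧
      2 ^ k * y (m + 1) ≤ y (m + 2 * k + 1) := by
    intro k
    induction k with
    | zero => exact ⟨hm, by simp⟩
    | succ k ih =>
      obtain ⟨h1, h2⟩ := step _ ih.1
      rw [show m + 2 * (k + 1) = m + 2 * k + 2 by ring]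
      refine ⟨h1, ?_⟩
      calc 2 ^ (k + 1) * y (m + 1) = 2 * (2 ^ k * y (m + 1)) := by ring
        _ ≤ 2 * y (m + 2 * k + 1) := by linarith [ih.2]
        _ ≤ _ := h2
  obtain ⟨k, hk⟩ := pow_unbounded_of_one_lt (K / y (m + 1)) (by norm_num : (1 : ℝ) < 2)
  rw [div_lt_iff₀ (hpos _)] at hk
  linarith [(grow k).2, hK (m + 2 * k + 1)]

/-- Dividing by the oldest term instead, s_n = y_{n+1}/y_n satisfies s_n(B + A s_{n+1} -
s_{n+1}s_{n+2}) = C. The contraction now runs from later indices to earlier ones, and its limiting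
fixed point is l. -/
theorem SatisfiesRecursion.hasLogRate_of_bounded {y : ℕ → ℝ} (h : SatisfiesRecursion y)
    (hpos : ∀ n, 0 < y n) {K : ℝ} (hK : ∀ n, y n ≤ K) {l : ℝ} (hl : 0 < l) (hl' : l ≤ 1 / 100)
    (hroot : l ^ 3 - 188 * l ^ 2 - 2368 * l + 4 = 0) : HasLogRate y (Real.log l) := by
  have hd := h.decay hpos hK
  refine hasLogRate_of_tendsto_ratio hl.ne' (Eventually.of_forall fun n => (hpos n).ne') ?_
  refine tendsto_of_contraction (u := fun n => n + 1) (v := fun n => n + 2)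
    (tendsto_add_atTop_nat 1) (tendsto_add_atTop_nat 2) tendsto_recB_div tendsto_recA_div
    (tendsto_const_nhds (x := (1 : ℝ))) tendsto_recC_div (Eventually.of_forall fun n => ?_)
    ⟨hl.le, hl'⟩ (by norm_num) (by norm_num) (by norm_num) (Eventually.of_forall fun m => ?_)
    (by linarith)
  · refine ⟨(div_pos (hpos _) (hpos _)).le, ?_⟩
    rw [div_le_iff₀ (hpos _)]
    exact hd n
  · have e := h.eq_div m
    have p0 := hpos m
    have p1 := hpos (m + 1)
    have p2 := hpos (m + 2)
    simp only [show m + 1 + 1 = m + 2 by omega, show m + 2 + 1 = m + 3 by omega]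
    generalize recA m / recDen m = A at *
    generalize recB m / recDen m = B at *
    generalize recC m / recDen m = C at *
    field_simp
    linarith

/-- As x is bounded below by c, the additive error K is at most a constant factor 1 + K/c, whose
logarithm vanishes after division by n. -/
theorem HasLogRate.of_bounded_difference {x y : ℕ → ℝ} {a c K : ℝ} (h : HasLogRate x a)
    (hc : 0 < c) (hx : ∀ n, 1 ≤ n → c ≤ x n) (hxy : ∀ n, 1 ≤ n → x n ≤ y n)
    (hy : ∀ n, 1 ≤ n → y n ≤ x n + K) : HasLogRate y a := by
  have hK : 0 ≤ K := by linarith [hxy 1 le_rfl, hy 1 le_rfl]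
  have hu : Tendsto (fun n : ℕ => Real.log |x n| / (n : ℝ) + Real.log (1 + K / c) * (n : ℝ)⁻¹)
      atTop (𝓝 a) := by
    simpa using h.add (tendsto_inv_atTop_nhds_zero_nat.const_mul (Real.log (1 + K / c)))
  refine tendsto_of_tendsto_of_tendsto_of_le_of_le' h hu ?_ ?_
  · filter_upwards [eventually_ge_atTop 1] with n hn
    have h1 := hx n hn
    have h2 := hxy n hn
    rw [Real.log_abs, Real.log_abs]
    gcongr
    linarith
  · filter_upwards [eventually_ge_atTop 1] with n hn
    have h1 := hx n hn
    have h2 := hxy n hn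
    have h3 : y n ≤ x n * (1 + K / c) := by
      have : K ≤ x n * (K / c) := by
        calc K = c * (K / c) := by field_simp
          _ ≤ _ := by gcongr
      linarith [hy n hn]
    rw [← div_eq_mul_inv, ← add_div, Real.log_abs, Real.log_abs,
      ← Real.log_mul (by linarith) (by positivity)]
    gcongr
    linarith

end Rates

/-! ### Roots of the characteristic polynomial. -/

section Roots

theorem exists_roots : ∃ l₁ l₂ l₃ : ℝ,
    (∀ x : ℝ, x ^ 3 - 188 * x ^ 2 - 2368 * x + 4 = (x - l₁) * (x - l₂) * (x - l₃)) ∧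
    0 < l₁ ∧ l₁ ≤ 1 / 100 ∧ -20 < l₂ ∧ l₂ < -1 ∧ 100 ≤ l₃ := by
  set p : ℝ → ℝ := fun x => x ^ 3 - 188 * x ^ 2 - 2368 * x + 4 with hp
  have hc : Continuous p := by fun_prop
  obtain ⟨l₁, ⟨h1, h1'⟩, e1⟩ := intermediate_value_Icc' (by norm_num : (0 : ℝ) ≤ 1 / 100)
    hc.continuousOn (show (0 : ℝ) ∈ Set.Icc (p (1 / 100)) (p 0) by
      constructor <;> norm_num [hp])
  obtain ⟨l₂, ⟨h2, h2'⟩, e2⟩ := intermediate_value_Icc (by norm_num : (-19 : ℝ) ≤ -2)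
    hc.continuousOn (show (0 : ℝ) ∈ Set.Icc (p (-19)) (p (-2)) by
      constructor <;> norm_num [hp])
  obtain ⟨l₃, ⟨h3, h3'⟩, e3⟩ := intermediate_value_Icc (by norm_num : (100 : ℝ) ≤ 300)
    hc.continuousOn (show (0 : ℝ) ∈ Set.Icc (p 100) (p 300) by
      constructor <;> norm_num [hp])
  simp only [hp] at e1 e2 e3
  have h0 : 0 < l₁ := h1.lt_of_ne fun h => by
    rw [← h] at e1
    norm_num at e1
  -- Divided differences at the three distinct roots; the last one gives the sum of the roots and
  -- hence the factorization.
  have q2 : l₁ ^ 2 + l₁ * l₂ + l₂ ^ 2 - 188 * (l₁ + l₂) - 2368 = 0 := by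
    have : l₁ - l₂ ≠ 0 := by linarith
    apply mul_left_cancel₀ this
    linear_combination e1 - e2
  have q3 : l₁ ^ 2 + l₁ * l₃ + l₃ ^ 2 - 188 * (l₁ + l₃) - 2368 = 0 := by
    have : l₁ - l₃ ≠ 0 := by linarith
    apply mul_left_cancel₀ this
    linear_combination e1 - e3
  have q : l₁ + l₂ + l₃ - 188 = 0 := by
    have : l₂ - l₃ ≠ 0 := by linarith
    apply mul_left_cancel₀ this
    linear_combination q2 - q3
  have e3' : l₃ = 188 - l₁ - l₂ := by linarith
  refine ⟨l₁, l₂, l₃, fun x => ?_, h0, h1', by linarith, by linarith, h3⟩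
  rw [e3']
  linear_combination (x - l₁) * q2 + e1

end Roots

/-! ### Growth of the three sequences and assembly of the result. -/

section Main

theorem zetaSum_pos {s : ℕ} (hs : 1 < s) : 0 < zetaSum s := by
  rw [zetaSum, if_neg hs.ne']
  exact (Real.summable_one_div_nat_pow.2 hs).tsum_pos (fun n => by positivity) 1 (by norm_num)

theorem ut_growth (n : ℕ) : 0 < (ut (n + 1) : ℝ) ∧ 100 * (ut (n + 1) : ℝ) ≤ ut (n + 2) :=
  (ut_satisfiesRecursion.map (Rat.castHom ℝ)).growth (by simp [ut_zero]) (by simp [ut_one])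
    (by simp [ut_one, ut_two]; norm_num) n

theorem wt_growth (n : ℕ) : 0 < (wt (n + 1) : ℝ) ∧ 100 * (wt (n + 1) : ℝ) ≤ wt (n + 2) :=
  (wt_satisfiesRecursion.map (Rat.castHom ℝ)).growth (by simp [wt_zero]) (by simp [wt_one])
    (by simp [wt_one, wt_two]; norm_num) n

theorem zetaForm_growth (n : ℕ) :
    0 < zetaForm (n + 1) ∧ 100 * zetaForm (n + 1) ≤ zetaForm (n + 2) := by
  have z5 := zetaSum_pos (s := 5) (by norm_num)
  have z3 := zetaSum_pos (s := 3) (by norm_num)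
  obtain ⟨u1, u2⟩ := ut_growth n
  obtain ⟨w1, w2⟩ := wt_growth n
  have a := mul_le_mul_of_nonneg_right u2 z5.le
  have b := mul_le_mul_of_nonneg_right w2 z3.le
  refine ⟨by rw [zetaForm]; positivity, ?_⟩
  rw [zetaForm, zetaForm]
  linarith

theorem zetaForm_one_le (n : ℕ) : zetaForm 1 ≤ zetaForm (n + 1) := by
  induction n with
  | zero => exact le_rfl
  | succ n ih =>
    obtain ⟨h1, h2⟩ := zetaForm_growth n
    change _ ≤ zetaForm (n + 2)
    linarith

theorem neg_rt_satisfiesRecursion : SatisfiesRecursion fun n => -rt n := by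
  simpa using rt_satisfiesRecursion.mul_const (-1)

end Main

end Zeta5

theorem theorem3 :
    -- the series converge, and their sums are linear forms in `ζ(5)`, `ζ(3)`, `1`
    (∀ n : ℕ, Summable (fun k : ℕ => Zeta5.summand n ((k : ℝ) + 1))) ∧
    (∀ n : ℕ, ((Zeta5.rt n : ℝ) : ℂ) =
      (Zeta5.ut n : ℂ) * riemannZeta 5 + (Zeta5.wt n : ℂ) * riemannZeta 3 - (Zeta5.vt n : ℂ)) ∧
    -- the recursion
    Zeta5.SatisfiesRecursion Zeta5.rt ∧
    Zeta5.SatisfiesRecursion Zeta5.ut ∧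
    Zeta5.SatisfiesRecursion Zeta5.wt ∧
    Zeta5.SatisfiesRecursion Zeta5.vt ∧
    -- the signs
    (∀ n : ℕ, 1 ≤ n →
      Zeta5.rt n < 0 ∧ 0 < Zeta5.ut n ∧ 0 < Zeta5.wt n ∧ 0 < Zeta5.vt n) ∧
    -- the growth rates, with the roots of the characteristic polynomial ordered by modulus
    (∃ l₁ l₂ l₃ : ℝ,
      (∀ x : ℝ, x ^ 3 - 188 * x ^ 2 - 2368 * x + 4 = (x - l₁) * (x - l₂) * (x - l₃)) ∧
      |l₁| < |l₂| ∧ |l₂| < |l₃| ∧ 0 < l₁ ∧ 0 < l₃ ∧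
      Zeta5.HasLogRate Zeta5.rt (Real.log l₁) ∧
      Zeta5.HasLogRate (fun n => (Zeta5.ut n : ℝ)) (Real.log l₃) ∧
      Zeta5.HasLogRate (fun n => (Zeta5.wt n : ℝ)) (Real.log l₃) ∧
      Zeta5.HasLogRate (fun n => (Zeta5.vt n : ℝ)) (Real.log l₃)) := by
  open Zeta5 in
  obtain ⟨l₁, l₂, l₃, hroots, h1, h1', h2, h2', h3⟩ := exists_roots
  have hl1 : l₁ ^ 3 - 188 * l₁ ^ 2 - 2368 * l₁ + 4 = 0 := by rw [hroots]; ring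
  have hl3 : l₃ ^ 3 - 188 * l₃ ^ 2 - 2368 * l₃ + 4 = 0 := by rw [hroots]; ring
  have hv : ∀ n, (vt n : ℝ) = zetaForm n - rt n := fun n => by rw [vt_eq]; ring
  refine ⟨summable_term, rt_eq_riemannZeta, rt_satisfiesRecursion, ut_satisfiesRecursion,
    wt_satisfiesRecursion, vt_satisfiesRecursion, fun n hn => ?_, l₁, l₂, l₃, hroots, ?_, ?_, h1,
    by linarith, ?_, ?_, ?_, ?_⟩
  · obtain ⟨k, rfl⟩ := Nat.exists_eq_add_of_le' hn
    refine ⟨rt_neg _, by exact_mod_cast (ut_growth k).1, by exact_mod_cast (wt_growth k).1, ?_⟩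
    have : (0 : ℝ) < vt (k + 1) := by
      rw [hv]
      linarith [rt_neg (k + 1), (zetaForm_growth k).1]
    exact_mod_cast this
  · rw [abs_of_pos h1, abs_of_neg (by linarith)]
    linarith
  · rw [abs_of_neg (by linarith), abs_of_pos (by linarith)]
    linarith
  · have := neg_rt_satisfiesRecursion.hasLogRate_of_bounded (fun n => neg_pos.2 (rt_neg n))
      (fun n => (neg_le_abs _).trans (abs_rt_le n)) h1 h1' hl1
    simpa only [HasLogRate, abs_neg] using this
  · exact (ut_satisfiesRecursion.map (Rat.castHom ℝ)).hasLogRate_of_growth ut_growth h3 hl3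
  · exact (wt_satisfiesRecursion.map (Rat.castHom ℝ)).hasLogRate_of_growth wt_growth h3 hl3
  -- The rate of `vt` is that of `zetaForm`, since `vt - zetaForm = -rt` is positive and bounded.
  · have hz := zetaForm_satisfiesRecursion.hasLogRate_of_growth zetaForm_growth h3 hl3
    refine hz.of_bounded_difference (zetaForm_growth 0).1 (fun n hn => ?_) (fun n _ => ?_)
      (fun n _ => ?_) (K := ∑' k : ℕ, 3 / ((k : ℝ) + 1) ^ 3)
    · obtain ⟨k, rfl⟩ := Nat.exists_eq_add_of_le' hn
      exact zetaForm_one_le k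
    · rw [hv]
      linarith [rt_neg n]
    · rw [hv]
      linarith [abs_rt_le n, neg_le_abs (rt n)]
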